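/- Let $X$ be a finite connected CW complex, with $k$-skeleta $X^{(k)}$ and finite sets $X_k$ of (oriented) $k$-cells. Let $C_*(X;A)$ be its cellular chain complex with coefficients in $A\in\{\mathbb Z,\mathbb R\}$, so that $C_k(X;A)$ is free on $X_k$; let $Z_k$, $B_k$, $H_k$ denote its cycles, boundaries and homology, and give $C_k(X;\mathbb R)$ the inner product for which $X_k$ is orthonormal. Let $\mathfrak h$ be a combinatorial homology basis: for each $k$, $\mathfrak h_k$ is a basis of $H_k(X;\mathbb R)$ that is a $\mathbb Z$-basis of the lattice $H_k(X;\mathbb Z)_0:=\operatorname{im}(H_k(X;\mathbb Z)\to H_k(X;\mathbb R))$. Choose bases $\mathfrak b_k$ of $B_k(X;\mathbb R)$ (with $B_{-1}=0$), linear splittings $B_{k-1}\to C_k$ and $H_k\to Z_k$ of $\partial\colon C_k\to B_{k-1}$ and of $Z_k\to H_k$ over $\mathbb R$, and orderings of all bases. Let $[\mathfrak b_k\mathfrak h_k\mathfrak b_{k-1}/\mathfrak c_k]$ be the matrix that expresses the resulting basis of $C_k(X;\mathbb R)$ (made of $\mathfrak b_k$ and the lifts of $\mathfrak h_k$ and $\mathfrak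 b_{k-1}$) in the basis $\mathfrak c_k=X_k$. The Milnor–Reidemeister torsion is $$\tau(X;\mathfrak h)=\prod_{k\ge 0}\det[\mathfrak b_k\mathfrak h_k\mathfrak b_{k-1}/\mathfrak c_k]^{(-1)^k}.$$ For $k\ge 0$ define the following. - $\mathcal T_{k+1}$ is the set of spanning trees of $X^{(k+1)}$, regarded as a complex of dimension at most $k+1$: subcomplexes $T$ with $X^{(k)}\subseteq T\subseteq X^{(k+1)}$, $H_{k+1}(T;\mathbb Z)=0$ and $\dim H_k(T;\mathbb R)=\dim H_k(X^{(k+1)};\mathbb R)$. For $T\in\mathcal T_{k+1}$, $\theta_T$ is the order of the torsion subgroup of $H_k(T;\mathbb Z)$. - $\theta_k$ is the order of the torsion subgroup of $H_k(X;\mathbb Z)$. - $\mu_k$ is the square of the covolume of the lattice $B_k(X;\mathbb Z)$ in $B_k(X;\mathbb R)$. - $\eta_k$ is the square of the covolume of the lattice $H_k(X;\mathbb Z)_0$ in $H_k(X;\mathbb R)$, where $H_k(X;\mathbb R)$ is identified with the orthogonal complement of $B_k(X;\mathbb R)$ in $Z_k(X;\mathbb R)$. - $\delta_k=\eta_k\mu_k/\theta_k^2$.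 Then, for all such choices, $$\tau(X;\mathfrak h)^2=\prod_{k\ge 0}\Bigl(\delta_k\sum_{T\in\mathcal T_{k+1}}\theta_T^2\Bigr)^{(-1)^k}.$$ -/

import Mathlib

namespace TorsionTree

universe u

noncomputable section

/-! ### Relative singular homology with integer coefficients -/

section Singular

open CategoryTheory CategoryTheory.Limits

/-- The singular chain complex with integer coefficients. -/
abbrev singularChains : TopCat.{u} ⥤ ChainComplex (ModuleCat.{u} ℤ) ℕ :=
  (AlgebraicTopology.singularChainComplexFunctor (ModuleCat.{u} ℤ)).obj
    (ModuleCat.of ℤ (ULift.{u} ℤ))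

/-- The relative singular chain complex `S(Y) / S(A)` of a map `i : A ⟶ Y`
(used for inclusions of subspaces). -/
abbrev relChains {A Y : TopCat.{u}} (i : A ⟶ Y) : ChainComplex (ModuleCat.{u} ℤ) ℕ :=
  cokernel (singularChains.map i)

/-- Relative singular homology `H_n(Y, A; ℤ)`. -/
abbrev relHomology {A Y : TopCat.{u}} (i : A ⟶ Y) (n : ℕ) : ModuleCat.{u} ℤ :=
  (relChains i).homology n

/-- The map `H_n(Y, A) ⟶ H_n(Y', A')` induced by a map of pairs. -/
def relHomologyMap {A Y A' Y' : TopCat.{u}} (i : A ⟶ Y) (i' : A' ⟶ Y')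
    (f : A ⟶ A') (g : Y ⟶ Y') (w : i ≫ g = f ≫ i') (n : ℕ) :
    relHomology i n ⟶ relHomology i' n :=
  HomologicalComplex.homologyMap
    (cokernel.map (singularChains.map i) (singularChains.map i')
      (singularChains.map f) (singularChains.map g)
      (by rw [← Functor.map_comp, ← Functor.map_comp, w])) n

/-- The short complex `S(A) ⟶ S(Y) ⟶ S(Y, A)`. -/
abbrev pairComplex {A Y : TopCat.{u}} (i : A ⟶ Y) :
    ShortComplex (ChainComplex (ModuleCat.{u} ℤ) ℕ) :=
  ShortComplex.mk (singularChains.map i) (cokernel.π (singularChains.map i))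
    (cokernel.condition _)

lemma pairComplex_shortExact {A Y : TopCat.{u}} (i : A ⟶ Y) [Mono i] :
    (pairComplex i).ShortExact :=
  { exact := ShortComplex.exact_cokernel _
    mono_f := by dsimp only [pairComplex]; infer_instance
    epi_g := by dsimp only [pairComplex]; infer_instance }

/-- The connecting homomorphism `H_{n+1}(Y, A) ⟶ H_n(A)` of the long exact sequence. -/
def connecting {A Y : TopCat.{u}} (i : A ⟶ Y) [Mono i] (n : ℕ) :
    relHomology i (n + 1) ⟶ (singularChains.obj A).homology n :=
  (pairComplex_shortExact i).δ (n + 1) n rfl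

/-- The map `H_n(Y) ⟶ H_n(Y, A)`. -/
def toRelHomology {A Y : TopCat.{u}} (i : A ⟶ Y) (n : ℕ) :
    (singularChains.obj Y).homology n ⟶ relHomology i n :=
  HomologicalComplex.homologyMap (cokernel.π (singularChains.map i)) n

lemma toRelHomology_connecting {A Y : TopCat.{u}} (i : A ⟶ Y) [Mono i] (n : ℕ) :
    toRelHomology i (n + 1) ≫ connecting i n = 0 :=
  (pairComplex_shortExact i).comp_δ (n + 1) n rfl

/-- The boundary map `H_{n+1}(Y, B) ⟶ H_n(B, A)` of a triple `A ⊆ B ⊆ Y`. -/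
def tripleBoundary {A B Y : TopCat.{u}} (i : A ⟶ B) (j : B ⟶ Y) [Mono j] (n : ℕ) :
    relHomology j (n + 1) ⟶ relHomology i n :=
  connecting j n ≫ toRelHomology i n

lemma tripleBoundary_comp {A B Y Z : TopCat.{u}} (i : A ⟶ B) (j : B ⟶ Y) (l : Y ⟶ Z)
    [Mono j] [Mono l] (n : ℕ) :
    tripleBoundary j l (n + 1) ≫ tripleBoundary i j n = 0 := by
  unfold tripleBoundary
  rw [Category.assoc, ← Category.assoc (toRelHomology j (n + 1)),
    toRelHomology_connecting, zero_comp, comp_zero]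

/-- The inclusion of a subspace into a larger subspace. -/
def inclusion {X : Type u} [TopologicalSpace X] {A B : Set X} (h : A ⊆ B) :
    TopCat.of A ⟶ TopCat.of B :=
  TopCat.ofHom ⟨Set.inclusion h, continuous_inclusion h⟩

instance {X : Type u} [TopologicalSpace X] {A B : Set X} (h : A ⊆ B) : Mono (inclusion h) :=
  (TopCat.mono_iff_injective _).2 (Set.inclusion_injective h)

/-- The closed unit `n`-disk (for the sup norm, as in the definition of CW complexes). -/
abbrev disk (n : ℕ) : TopCat.{u} :=
  TopCat.of (ULift.{u} (Metric.closedBall (0 : Fin n → ℝ) 1))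

/-- The unit `(n-1)`-sphere, the boundary of the `n`-disk. -/
abbrev diskSphere (n : ℕ) : TopCat.{u} :=
  TopCat.of (ULift.{u} (Metric.sphere (0 : Fin n → ℝ) 1))

/-- The inclusion of the sphere into the disk. -/
def sphereInclusion (n : ℕ) : diskSphere.{u} n ⟶ disk.{u} n :=
  TopCat.ofHom ⟨fun x => ⟨⟨x.down.1, Metric.sphere_subset_closedBall x.down.2⟩⟩, by fun_prop⟩

end Singular

/-! ### The cellular chain complex of a CW complex -/

section Cellular

open CategoryTheory Topology.RelCWComplex

variable {X : Type u} [TopologicalSpace X] [T2Space X] (C : Set X) [Topology.CWComplex C]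

/-- The inclusion `X^{(n-1)} ⟶ X^{(n)}` (the set `skeletonLT C n` is the `(n-1)`-skeleton). -/
abbrev skeletonInclusion (n : ℕ) :
    TopCat.of (skeletonLT C (n : ℕ∞) : Set X) ⟶ TopCat.of (skeletonLT C ((n + 1 : ℕ) : ℕ∞) : Set X) :=
  inclusion (skeletonLT_mono (C := C) (Nat.cast_le.2 (Nat.le_succ n)))

/-- The cellular chain group `C_n(X; ℤ) = H_n(X^{(n)}, X^{(n-1)}; ℤ)`. -/
abbrev CellularChains (n : ℕ) : ModuleCat.{u} ℤ := relHomology (skeletonInclusion C n) n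

/-- The boundary operator `H_{n+1}(X^{(n+1)}, X^{(n)}; ℤ) → H_n(X^{(n)}, X^{(n-1)}; ℤ)`. -/
abbrev cellularBoundary (n : ℕ) : CellularChains C (n + 1) ⟶ CellularChains C n :=
  tripleBoundary (skeletonInclusion C n) (skeletonInclusion C (n + 1)) n

variable {C}

lemma closedCell_subset_skeletonLT_cast (n : ℕ) (e : cell C n) :
    closedCell n e ⊆ (skeletonLT C ((n + 1 : ℕ) : ℕ∞) : Set X) := by
  rw [Nat.cast_succ]
  exact closedCell_subset_skeletonLT n e

/-- The characteristic map `D^n → X^{(n)}` of an `n`-cell. -/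
def charMap (n : ℕ) (e : cell C n) :
    disk.{u} n ⟶ TopCat.of (skeletonLT C ((n + 1 : ℕ) : ℕ∞) : Set X) :=
  TopCat.ofHom ⟨fun x => ⟨map n e x.down.1,
      closedCell_subset_skeletonLT_cast n e ⟨_, x.down.2, rfl⟩⟩,
    Continuous.subtype_mk ((continuousOn_iff_continuous_domRestrict.1 (continuousOn n e)).comp
      continuous_uliftDown) _⟩

/-- The attaching map `S^{n-1} → X^{(n-1)}` of an `n`-cell. -/
def attachMap (n : ℕ) (e : cell C n) :
    diskSphere.{u} n ⟶ TopCat.of (skeletonLT C (n : ℕ∞) : Set X) :=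
  TopCat.ofHom ⟨fun x => ⟨map n e x.down.1,
      cellFrontier_subset_skeletonLT n e ⟨_, x.down.2, rfl⟩⟩,
    Continuous.subtype_mk ((continuousOn_iff_continuous_domRestrict.1
      ((continuousOn n e).mono Metric.sphere_subset_closedBall)).comp
      continuous_uliftDown) _⟩

lemma attachMap_charMap (n : ℕ) (e : cell C n) :
    sphereInclusion n ≫ charMap n e = attachMap n e ≫ skeletonInclusion C n := rfl

variable (C) in
/-- An orientation of the cells: a generator of `H_n(D^n, S^{n-1}; ℤ) ≅ ℤ` for each `n`-cell. -/
def CellOrientation : Type u :=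
  ∀ (n : ℕ) (_ : cell C n),
    {o : relHomology (sphereInclusion.{u} n) n // Submodule.span ℤ {o} = ⊤}

/-- The class in `C_n(X; ℤ) = H_n(X^{(n)}, X^{(n-1)}; ℤ)` of an oriented cell. -/
def cellClass (o : CellOrientation C) (n : ℕ) (e : cell C n) : CellularChains C n :=
  (relHomologyMap (sphereInclusion n) (skeletonInclusion C n) (attachMap n e) (charMap n e)
    (attachMap_charMap n e) n).hom (o n e).1

/-- The map `ℤ[X_n] → C_n(X; ℤ)` that sends an `n`-cell to its class. -/
def cellClassMap (o : CellOrientation C) (n : ℕ) :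
    (cell C n →₀ ℤ) →ₗ[ℤ] CellularChains C n :=
  Finsupp.linearCombination ℤ (cellClass o n)

open Classical in
/-- The cellular boundary operator in the bases of oriented cells. That the cells form a basis of
`C_n(X; ℤ)` is a classical fact, so that the first case is the one that occurs for every CW
complex; the second case only makes the definition total. -/
def cellBoundary (o : CellOrientation C) (n : ℕ) :
    (cell C (n + 1) →₀ ℤ) →ₗ[ℤ] (cell C n →₀ ℤ) :=
  if h : Function.Bijective (cellClassMap o n) then
    (LinearEquiv.ofBijective (cellClassMap o n) h).symm.toLinearMap ∘ₗ
      (cellularBoundary C n).hom ∘ₗ cellClassMap o (n + 1)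
  else 0

lemma cellBoundary_comp (o : CellOrientation C) (n : ℕ) :
    cellBoundary o n ∘ₗ cellBoundary o (n + 1) = 0 := by
  classical
  by_cases h1 : Function.Bijective (cellClassMap o (n + 1))
  · by_cases h0 : Function.Bijective (cellClassMap o n)
    · ext1 x
      ext1
      simp only [cellBoundary, dif_pos h1, dif_pos h0, LinearMap.comp_apply,
        LinearEquiv.coe_coe, LinearMap.zero_apply]
      have e : ∀ y, cellClassMap o (n + 1)
          ((LinearEquiv.ofBijective (cellClassMap o (n + 1)) h1).symm y) = y := fun y =>
        LinearEquiv.apply_symm_apply (LinearEquiv.ofBijective (cellClassMap o (n + 1)) h1) y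
      rw [e]
      have z := tripleBoundary_comp (skeletonInclusion C n) (skeletonInclusion C (n + 1))
        (skeletonInclusion C (n + 1 + 1)) n
      have z' := fun y => LinearMap.congr_fun (congrArg ModuleCat.Hom.hom z) y
      simp only [ModuleCat.hom_comp, LinearMap.comp_apply] at z'
      rw [z']
      simp
    · simp [cellBoundary, dif_neg h0]
  · simp [cellBoundary, dif_neg h1]

/-- The incidence numbers `⟨∂e, f⟩` of the `(n+1)`-cells `e` and the `n`-cells `f`. -/
def incidence (o : CellOrientation C) (n : ℕ) : Matrix (cell C n) (cell C (n + 1)) ℤ :=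
  Matrix.of fun f e => cellBoundary o n (Finsupp.single e 1) f

variable [Topology.CWComplex.Finite C]

instance cellFintype (n : ℕ) : Fintype (cell C n) :=
  @Fintype.ofFinite _ (FiniteType.finite_cell n)

/-- The boundary operator `∂ : C_{n+1}(X; A) → C_n(X; A)` of the cellular chain complex with
coefficients in `A`, where `C_n(X; A)` is the free `A`-module on the (finite) set of `n`-cells. -/
def boundary (o : CellOrientation C) (A : Type) [CommRing A] (n : ℕ) :
    (cell C (n + 1) → A) →ₗ[A] (cell C n → A) :=
  ((incidence o n).map (Int.cast : ℤ → A)).mulVecLin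

lemma incidence_mul (o : CellOrientation C) (n : ℕ) :
    incidence o n * incidence o (n + 1) = 0 := by
  classical
  ext f e
  have h := DFunLike.congr_fun
    (LinearMap.congr_fun (cellBoundary_comp o n) (Finsupp.single e 1)) f
  simp only [LinearMap.comp_apply, LinearMap.zero_apply, Finsupp.coe_zero, Pi.zero_apply] at h
  rw [Matrix.mul_apply, Matrix.zero_apply, ← h]
  conv_rhs => rw [← Finsupp.univ_sum_single (cellBoundary o (n + 1) (Finsupp.single e 1))]
  rw [map_sum, Finsupp.finsetSum_apply]
  refine Finset.sum_congr rfl fun g _ => ?_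
  have hs : (Finsupp.single g (cellBoundary o (n + 1) (Finsupp.single e 1) g) : cell C (n + 1) →₀ ℤ)
      = (cellBoundary o (n + 1) (Finsupp.single e 1) g) • Finsupp.single g 1 := by simp
  rw [hs, map_smul, Finsupp.smul_apply, smul_eq_mul, mul_comm]
  rfl

/-- The boundary operators form a chain complex. -/
lemma boundary_boundary (o : CellOrientation C) (A : Type) [CommRing A] (n : ℕ)
    (c : cell C (n + 1 + 1) → A) : boundary o A n (boundary o A (n + 1) c) = 0 := by
  have h := congrArg (fun M => M.map (Int.castRingHom A)) (incidence_mul o n)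
  simp only [Matrix.map_mul] at h
  simp only [boundary, Matrix.mulVecLin_apply, Matrix.mulVec_mulVec]
  have h' : (incidence o n).map (Int.cast : ℤ → A) *
      (incidence o (n + 1)).map (Int.cast : ℤ → A) = 0 := by
    refine h.trans ?_
    ext
    simp
  rw [h', Matrix.zero_mulVec]

/-! ### Cellular homology of a subcomplex

The cellular chain complex of a subcomplex `T` is the part of that of `X` spanned by the cells of
`T`. A subcomplex enters through its sets of cells, `T.I n` in dimension `n`. -/

variable (C) in
/-- The set of all cells of `X`. -/
abbrev allCells : ∀ n, Set (cell C n) := fun _ => Set.univ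

/-- `C_n(T; A)`. -/
def chains (A : Type) [CommRing A] (I : ∀ n, Set (cell C n)) (n : ℕ) :
    Submodule A (cell C n → A) where
  carrier := {c | ∀ e, e ∉ I n → c e = 0}
  add_mem' ha hb e he := by simp [ha e he, hb e he]
  zero_mem' _ _ := rfl
  smul_mem' r c hc e he := by simp [hc e he]

/-- The cycles `Z_n(T; A)`. -/
def cycles (o : CellOrientation C) (A : Type) [CommRing A] (I : ∀ n, Set (cell C n)) :
    ∀ n : ℕ, Submodule A (cell C n → A)
  | 0 => chains A I 0
  | n + 1 => chains A I (n + 1) ⊓ LinearMap.ker (boundary o A n)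

/-- The boundaries `B_n(T; A)`. -/
def boundaries (o : CellOrientation C) (A : Type) [CommRing A] (I : ∀ n, Set (cell C n)) (n : ℕ) :
    Submodule A (cell C n → A) :=
  (chains A I (n + 1)).map (boundary o A n)

/-- The cellular homology `H_n(T; A) = Z_n(T; A) / B_n(T; A)`. -/
abbrev Homology (o : CellOrientation C) (A : Type) [CommRing A] (I : ∀ n, Set (cell C n))
    (n : ℕ) : Type u :=
  cycles o A I n ⧸ (boundaries o A I n).submoduleOf (cycles o A I n)

/-- The Betti number `β_n(T) = dim H_n(T; ℝ)`. -/
def betti (o : CellOrientation C) (I : ∀ n, Set (cell C n)) (n : ℕ) : ℕ :=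
  Module.finrank ℝ (Homology o ℝ I n)

/-- The order of the torsion subgroup of `H_n(T; ℤ)`. -/
def torsionOrder (o : CellOrientation C) (I : ∀ n, Set (cell C n)) (n : ℕ) : ℕ :=
  Nat.card (AddCommGroup.torsion (Homology o ℤ I n))

/-! ### Spanning trees of skeleta -/

/-- `T` is a spanning tree of `X^{(k+1)}`, regarded as a complex of dimension at most `k + 1`. -/
structure IsSpanningTree (o : CellOrientation C) (k : ℕ) (T : Subcomplex C) : Prop where
  le_skeleton : T ≤ skeleton C ((k + 1 : ℕ) : ℕ∞)
  homology_top : Subsingleton (Homology o ℤ T.I (k + 1))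
  betti_eq : betti o T.I k = betti o (skeleton C ((k + 1 : ℕ) : ℕ∞)).I k
  skeleton_le : skeleton C (k : ℕ∞) ≤ T

instance subcomplex_finite : Finite (Subcomplex C) := by
  obtain ⟨N, hN⟩ := Filter.eventually_atTop.1 (FiniteDimensional.eventually_isEmpty_cell (C := C) (D := ∅))
  refine Finite.of_injective
    (fun (T : Subcomplex C) (n : Fin N) => (T.I n : Set (cell C (n : ℕ)))) fun S T h => ?_
  have hI : ∀ n, S.I n = T.I n := by
    intro n
    by_cases hn : n < N
    · exact congrFun h ⟨n, hn⟩
    · have := hN n (not_lt.1 hn)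
      exact Subsingleton.elim _ _
  have hI' : S.I = T.I := funext hI
  refine SetLike.coe_injective ?_
  rw [← S.union, ← T.union, hI']

/-- The (finite) set of spanning trees of `X^{(k+1)}`. -/
def spanningTrees (o : CellOrientation C) (k : ℕ) : Finset (Subcomplex C) :=
  (Set.toFinite {T : Subcomplex C | IsSpanningTree o k T}).toFinset

/-! ### The lattices and their covolumes -/

/-- The chain map `C_n(X; ℤ) → C_n(X; ℝ)`. -/
def realChain (n : ℕ) : (cell C n → ℤ) →ₗ[ℤ] (cell C n → ℝ) where
  toFun c e := c e
  map_add' _ _ := by ext; simp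
  map_smul' _ _ := by ext; simp

lemma realChain_boundary (o : CellOrientation C) (n : ℕ) (c : cell C (n + 1) → ℤ) :
    realChain n (boundary o ℤ n c) = boundary o ℝ n (realChain (n + 1) c) := by
  ext e
  simp [realChain, boundary, Matrix.mulVec, dotProduct]

lemma realChain_mem_cycles (o : CellOrientation C) (I : ∀ n, Set (cell C n)) (n : ℕ)
    {c : cell C n → ℤ} (hc : c ∈ cycles o ℤ I n) : realChain n c ∈ cycles o ℝ I n := by
  cases n with
  | zero => exact fun e he => by simpa [realChain] using hc e he
  | succ n =>
    refine ⟨fun e he => by simpa [realChain] using hc.1 e he, ?_⟩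
    have h : boundary o ℤ n c = 0 := hc.2
    rw [SetLike.mem_coe, LinearMap.mem_ker, ← realChain_boundary, h, map_zero]

lemma realChain_mem_boundaries (o : CellOrientation C) (I : ∀ n, Set (cell C n)) (n : ℕ)
    {c : cell C n → ℤ} (hc : c ∈ boundaries o ℤ I n) : realChain n c ∈ boundaries o ℝ I n := by
  obtain ⟨a, ha, rfl⟩ := hc
  exact ⟨realChain (n + 1) a, fun e he => by simpa [realChain] using ha e he,
    (realChain_boundary o n a).symm⟩

/-- The homomorphism `H_n(X; ℤ) → H_n(X; ℝ)`. -/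
def realHomology (o : CellOrientation C) (I : ∀ n, Set (cell C n)) (n : ℕ) :
    Homology o ℤ I n →ₗ[ℤ] Homology o ℝ I n :=
  Submodule.liftQ _
    (((Submodule.mkQ ((boundaries o ℝ I n).submoduleOf (cycles o ℝ I n))).restrictScalars ℤ) ∘ₗ
      LinearMap.codRestrict ((cycles o ℝ I n).restrictScalars ℤ)
        (realChain n ∘ₗ (cycles o ℤ I n).subtype)
        (fun c => realChain_mem_cycles o I n c.2))
    (fun c hc => by
      rw [LinearMap.mem_ker]
      exact (Submodule.Quotient.mk_eq_zero _).2 (realChain_mem_boundaries o I n hc))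

/-- The lattice `H_n(X; ℤ)_0`, the image of `H_n(X; ℤ)` in `H_n(X; ℝ)`. -/
def homologyLattice (o : CellOrientation C) (n : ℕ) :
    Submodule ℤ (Homology o ℝ (allCells C) n) :=
  LinearMap.range (realHomology o (allCells C) n)

/-- `C_n(X; ℝ)` with the inner product in which the cells are orthonormal. -/
abbrev EuclideanChains (C : Set X) [Topology.CWComplex C] [Topology.CWComplex.Finite C] (n : ℕ) :
    Type u :=
  EuclideanSpace ℝ (cell C n)

/-- The identification of `C_n(X; ℝ)` with the corresponding inner product space. -/
abbrev toEuclidean (n : ℕ) : (cell C n → ℝ) ≃ₗ[ℝ] EuclideanChains C n :=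
  (WithLp.linearEquiv 2 ℝ (cell C n → ℝ)).symm

/-- `B_n(X; ℝ)` as a subspace of the inner product space `C_n(X; ℝ)`. -/
def boundarySpace (o : CellOrientation C) (n : ℕ) : Submodule ℝ (EuclideanChains C n) :=
  (boundaries o ℝ (allCells C) n).map (toEuclidean n).toLinearMap

/-- The lattice `B_n(X; ℤ)` in `B_n(X; ℝ)`. -/
def boundaryLattice (o : CellOrientation C) (n : ℕ) : Submodule ℤ (boundarySpace o n) :=
  ((boundaries o ℤ (allCells C) n).map (realChain n)).comap
    (((toEuclidean n).symm.toLinearMap ∘ₗ (boundarySpace o n).subtype).restrictScalars ℤ)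

/-- `μ_n`, the square of the covolume of `B_n(X; ℤ)` in `B_n(X; ℝ)`. -/
def mu (o : CellOrientation C) (n : ℕ) : ℝ := ZLattice.covolume (boundaryLattice o n) ^ 2

/-- The orthogonal complement of `B_n(X; ℝ)` in `Z_n(X; ℝ)`. -/
def harmonicSpace (o : CellOrientation C) (n : ℕ) : Submodule ℝ (EuclideanChains C n) :=
  (cycles o ℝ (allCells C) n).map (toEuclidean n).toLinearMap ⊓ (boundarySpace o n)ᗮ

lemma harmonicSpace_cycle (o : CellOrientation C) (n : ℕ) (x : harmonicSpace o n) :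
    (toEuclidean n).symm (x : EuclideanChains C n) ∈ cycles o ℝ (allCells C) n := by
  obtain ⟨z, hz, h⟩ := x.2.1
  rw [← h]
  exact hz

/-- The identification of the orthogonal complement of `B_n(X; ℝ)` in `Z_n(X; ℝ)` with
`H_n(X; ℝ)`: a cycle is sent to its homology class. -/
def harmonicToHomology (o : CellOrientation C) (n : ℕ) :
    harmonicSpace o n →ₗ[ℝ] Homology o ℝ (allCells C) n :=
  Submodule.mkQ _ ∘ₗ LinearMap.codRestrict (cycles o ℝ (allCells C) n)
    ((toEuclidean n).symm.toLinearMap ∘ₗ (harmonicSpace o n).subtype)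
    (harmonicSpace_cycle o n)

/-- `η_n`, the square of the covolume of `H_n(X; ℤ)_0` in `H_n(X; ℝ)`, for the inner product given
by the identification above. -/
def eta (o : CellOrientation C) (n : ℕ) : ℝ :=
  ZLattice.covolume ((homologyLattice o n).comap ((harmonicToHomology o n).restrictScalars ℤ)) ^ 2

/-- `δ_n = η_n μ_n / θ_n²`. -/
def delta (o : CellOrientation C) (n : ℕ) : ℝ :=
  eta o n * mu o n / (torsionOrder o (allCells C) n : ℝ) ^ 2

/-! ### Milnor's torsion -/

/-- A basis of `H_*(X; ℝ)`. -/
abbrev HomologyBasis (o : CellOrientation C) : Type u :=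
  ∀ n, Module.Basis (Fin (betti o (allCells C) n)) ℝ (Homology o ℝ (allCells C) n)

/-- The basis is combinatorial: its members in degree `n` form a basis of the lattice
`H_n(X; ℤ)_0`. (They are linearly independent over `ℝ`, hence over `ℤ`.) -/
def IsCombinatorial (o : CellOrientation C) (h : HomologyBasis o) : Prop :=
  ∀ n, Submodule.span ℤ (Set.range (h n)) = homologyLattice o n

/-- The dimension of `B_{n-1}(X; ℝ)`, where `B_{-1} = 0`. -/
def prevRank (o : CellOrientation C) : ℕ → ℕ
  | 0 => 0
  | n + 1 => Module.finrank ℝ (boundaries o ℝ (allCells C) n)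

/-- The auxiliary choices in the definition of the torsion of `C_*(X; ℝ)`: bases of the spaces of
boundaries, splittings of `0 → Z_{n+1} → C_{n+1} → B_n → 0` and `0 → B_n → Z_n → H_n → 0`, and
orderings of the bases, in the form of bijections of the sets of cells with the index sets of the
bases that they are compared with. -/
structure TorsionChoices (o : CellOrientation C) where
  /-- the basis `𝔟_n` of `B_n` -/
  b : ∀ n, Module.Basis (Fin (Module.finrank ℝ (boundaries o ℝ (allCells C) n))) ℝ
    (boundaries o ℝ (allCells C) n)
  /-- the splitting `B_n → C_{n+1}` -/
  s : ∀ n, boundaries o ℝ (allCells C) n →ₗ[ℝ] (cell C (n + 1) → ℝ)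
  s_spec : ∀ n x, boundary o ℝ n (s n x) = x
  /-- the splitting `H_n → Z_n` -/
  t : ∀ n, Homology o ℝ (allCells C) n →ₗ[ℝ] cycles o ℝ (allCells C) n
  t_spec : ∀ n x, Submodule.Quotient.mk (t n x) = x
  /-- the order in which the bases are compared -/
  ord : ∀ n, cell C n ≃ (Fin (Module.finrank ℝ (boundaries o ℝ (allCells C) n)) ⊕
    Fin (betti o (allCells C) n)) ⊕ Fin (prevRank o n)

/-- The lifts `s_{n-1}(b_{n-1}^i)` to `C_n` of the basis of `B_{n-1}`. -/
def liftedBasis {o : CellOrientation C} (D : TorsionChoices o) :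
    ∀ n, Fin (prevRank o n) → (cell C n → ℝ)
  | 0 => fun i => i.elim0
  | n + 1 => fun i => D.s n (D.b n i)

/-- The basis `𝔟_n 𝔥_n 𝔟_{n-1}` of `C_n(X; ℝ)`. -/
def newBasis {o : CellOrientation C} (h : HomologyBasis o) (D : TorsionChoices o) (n : ℕ) :
    (Fin (Module.finrank ℝ (boundaries o ℝ (allCells C) n)) ⊕
      Fin (betti o (allCells C) n)) ⊕ Fin (prevRank o n) → (cell C n → ℝ) :=
  Sum.elim (Sum.elim (fun i => (D.b n i : cell C n → ℝ))
    (fun i => (D.t n (h n i) : cell C n → ℝ))) (liftedBasis D n)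

open Classical in
/-- `[𝔟_n 𝔥_n 𝔟_{n-1} / 𝔠_n]`: the columns are the members of the new basis, expressed in the
basis of cells. -/
def changeOfBasis {o : CellOrientation C} (h : HomologyBasis o) (D : TorsionChoices o) (n : ℕ) :
    Matrix (cell C n) (cell C n) ℝ :=
  Matrix.of fun e f => newBasis h D n (D.ord n f) e

open Classical in
/-- The torsion `τ(X; 𝔥) = ∏_n det[𝔟_n 𝔥_n 𝔟_{n-1} / 𝔠_n]^{(-1)^n}`, computed with the given
choices. All factors beyond the dimension of `X` are `1`. -/
def torsion {o : CellOrientation C} (h : HomologyBasis o) (D : TorsionChoices o) : ℝ :=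
  ∏ᶠ n : ℕ, (changeOfBasis h D n).det ^ ((-1 : ℤ) ^ n)

end Cellular

end

end TorsionTree

namespace TorsionTree

universe u

open Module Matrix Topology.RelCWComplex

set_option linter.unusedSectionVars false

/-! Write `u k` for the determinant of the change of basis in degree `k`, `M k` for the matrix of `∂
: C_k → B_{k-1}` in the chosen basis of `B_{k-1}`, and `p k = det (M k * (M k)ᵀ)`. The formula
follows from the identity `δ_k ∑ θ_T² = (u k)² * p k * p (k + 1)` in each degree
(`delta_mul_sum_eq`). In the alternating product the `p k` cancel between neighbouring degrees. The
two ends contribute `1`, since `B_{-1} = 0` and there are no cells above the dimension of `X`.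

The identity has three ingredients. In `det_changeOfBasis_sq`, `C_k` splits orthogonally into
boundaries, harmonic cycles and the row space of `M k`; hence `(u k)² * p k` is `η_k` times the Gram
determinant of the chosen basis of `B_k`. In `det_gram_mul_det_boundaryMatrix_eq`, the product of
that Gram determinant with `p (k + 1)` is independent of the basis of `B_k`, so an integral basis
may be used, whose Gram determinant is `μ_k`.

Finally `sum_torsionOrder_sq` evaluates the remaining determinant by Cauchy–Binet, as a sum of
squared maximal minors of the integral boundary matrix. A minor is nonzero exactly when its columns
are the `(k+1)`-cells of a spanning tree `T`. Its absolute value is then the index of `B_k(T; ℤ)` in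
`B_k(X; ℤ)`; as `T` and `X` have the same `k`-cycles, this index is `θ_T / θ_k`. -/

/-! ### Linear algebra: Gram determinants, Cauchy–Binet and adapted bases. -/

theorem linearIndependent_coe_basis {R M ι : Type*} [Ring R] [AddCommGroup M] [Module R M]
    {p : Submodule R M} (b : Basis ι R p) : LinearIndependent R fun i => (b i : M) :=
  b.linearIndependent.map' p.subtype p.ker_subtype

/-- The squared covolume of the lattice spanned by a basis is its Gram determinant. -/
theorem covolume_span_range_sq {E ι : Type*} [NormedAddCommGroup E] [InnerProductSpace ℝ E]
    [FiniteDimensional ℝ E] [MeasurableSpace E] [BorelSpace E] [Fintype ι] [DecidableEq ι]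
    (b : Basis ι ℝ E) :
    ZLattice.covolume (Submodule.span ℤ (Set.range b)) ^ 2 = (Matrix.gram ℝ b).det := by
  have hcard : Module.finrank ℝ E = Fintype.card ι := Module.finrank_eq_card_basis b
  -- An orthonormal basis with the same index type spans a unit cube, so the covolume is the
  -- absolute determinant of `b` in the basis `a`, and the Gram matrix is the product of that
  -- coordinate matrix with its transpose.
  let a : OrthonormalBasis ι ℝ E := (stdOrthonormalBasis ℝ E).reindex
    (Fintype.equivOfCardEq (by simpa using hcard))
  have h1 : MeasureTheory.volume.real (ZSpan.fundamentalDomain a.toBasis) = 1 := by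
    rw [MeasureTheory.measureReal_def,
      MeasureTheory.measure_congr (ZSpan.fundamentalDomain_ae_parallelepiped a.toBasis _)]
    simpa using congrArg ENNReal.toReal a.volume_parallelepiped
  rw [ZLattice.covolume_eq_measure_fundamentalDomain _ _
    (ZSpan.isAddFundamentalDomain b MeasureTheory.volume),
    ZSpan.measureReal_fundamentalDomain b _ a.toBasis, h1, mul_one, sq_abs,
    Matrix.gram_eq_conjTranspose_mul a, Matrix.det_mul, Matrix.det_conjTranspose, star_trivial,
    ← sq]
  congr 2

/-- A form of the Cauchy–Binet formula: `det (M * Mᵀ)` is the sum of the squares of the maximal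
minors of `M`. -/
theorem det_mul_transpose_eq_sum {ι n R : Type*} [Fintype ι] [DecidableEq ι] [Fintype n]
    [DecidableEq n] [CommRing R] (M : Matrix ι n R) (w : Finset n → R)
    (hw : ∀ f : ι → n, Function.Injective f →
      (M.submatrix id f).det ^ 2 = w (Finset.univ.image f)) :
    (M * Mᵀ).det = ∑ S ∈ Finset.powersetCard (Fintype.card ι) Finset.univ, w S := by
  have h1 : (M * Mᵀ).det = ∑ f : ι → n, (∏ i, M i (f i)) * (M.submatrix id f).det := by
    simp only [det_apply', mul_apply, transpose_apply, Finset.prod_univ_sum,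
      Fintype.piFinset_univ, Finset.mul_sum, submatrix_apply, id_eq]
    rw [Finset.sum_comm]
    refine Finset.sum_congr rfl fun f _ => Finset.sum_congr rfl fun σ _ => ?_
    rw [Finset.prod_mul_distrib]
    ring
  have h2 : (M * Mᵀ).det = ∑ f : ι → n with Function.Injective f,
      (∏ i, M i (f i)) * (M.submatrix id f).det := by
    rw [h1]
    -- A non-injective choice of columns repeats a column.
    refine (Finset.sum_subset (Finset.filter_subset _ _) fun f _ hf => ?_).symm
    have hf' : ¬ Function.Injective f := by simpa using hf
    simp only [Function.Injective, not_forall] at hf'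
    obtain ⟨i, j, hij, hne⟩ := hf'
    rw [det_zero_of_column_eq hne (fun l => by simp [hij]), mul_zero]
  rw [h2, ← Finset.sum_fiberwise_of_maps_to
    (g := fun f => Finset.univ.image f) (t := Finset.powersetCard (Fintype.card ι) Finset.univ)]
  · refine Finset.sum_congr rfl fun S hS => ?_
    have hc : Fintype.card ι = Fintype.card S := by
      simpa using (Finset.mem_powersetCard.1 hS).2.symm
    let e : ι ≃ S := Fintype.equivOfCardEq hc
    let g : ι → n := fun i => e i
    have hg : Function.Injective g := Subtype.val_injective.comp e.injective
    have hgS : Finset.univ.image g = S := by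
      ext x
      simp only [Finset.mem_image, Finset.mem_univ, true_and]
      exact ⟨fun ⟨i, hi⟩ => hi ▸ (e i).2, fun hx => ⟨e.symm ⟨x, hx⟩, by simp [g]⟩⟩
    rw [← hgS, ← hw g hg, sq]
    nth_rewrite 1 [← det_transpose, det_apply']
    rw [Finset.sum_mul]
    -- The injective maps with image `S` are `g ∘ σ` for one fixed enumeration `g`. Permuting
    -- columns only changes the sign of the minor, and the signed sum over `σ` is the Leibniz
    -- expansion of the second copy of the minor.
    symm
    refine Finset.sum_bij (fun σ _ => g ∘ σ) ?_ ?_ ?_ ?_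
    · intro σ _
      simp only [Finset.mem_filter, Finset.mem_univ, true_and]
      refine ⟨hg.comp σ.injective, ?_⟩
      ext x
      simp only [Finset.mem_image, Finset.mem_univ, true_and, Function.comp_apply]
      exact ⟨fun ⟨i, hi⟩ => ⟨_, hi⟩, fun ⟨i, hi⟩ => ⟨σ.symm i, by simpa using hi⟩⟩
    · intro σ _ τ _ h
      ext i
      exact hg (congrFun h i)
    · intro f hf
      simp only [Finset.mem_filter, Finset.mem_univ, true_and] at hf
      have hmem : ∀ i, f i ∈ S := fun i => by
        rw [← hgS, ← hf.2]
        exact Finset.mem_image_of_mem _ (Finset.mem_univ _)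
      let τ : ι → ι := fun i => e.symm ⟨f i, hmem i⟩
      have hτ : Function.Injective τ := fun i j h =>
        hf.1 (congrArg Subtype.val (e.symm.injective h))
      exact ⟨Equiv.ofBijective τ (Finite.injective_iff_bijective.1 hτ), Finset.mem_univ _, by
        ext i
        simp [g, τ]⟩
    · intro σ _
      have : M.submatrix id (g ∘ σ) = (M.submatrix id g).submatrix id σ := rfl
      rw [this, det_permute']
      simp only [transpose_apply, submatrix_apply, id_eq, Function.comp_apply]
      ring
  · intro f hf
    simp only [Finset.mem_filter, Finset.mem_univ, true_and] at hf
    simp [Finset.mem_powersetCard, Finset.card_image_of_injective _ hf]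

/-- The squared determinant of a basis adapted to a decomposition `(B ⊕ H) ⊕ N`, where `H` is
orthogonal to `B` and `M` vanishes on `B ⊕ H` and is dual to the basis of `N`. -/
theorem det_adapted_basis_sq {n α β γ K : Type*} [Fintype n] [DecidableEq n] [Fintype α]
    [DecidableEq α] [Fintype β] [DecidableEq β] [Fintype γ] [DecidableEq γ] [Field K]
    (ord : n ≃ (α ⊕ β) ⊕ γ) (b : Matrix n α K) (t h : Matrix n β K) (s : Matrix n γ K)
    (M : Matrix γ n K) (X : Matrix α β K) (hbh : bᵀ * h = 0) (hMb : M * b = 0) (hMh : M * h = 0)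
    (hMs : M * s = 1) (ht : t = h + b * X) (hb0 : (bᵀ * b).det ≠ 0) (hh0 : (hᵀ * h).det ≠ 0) :
    ((fromCols (fromCols b t) s).submatrix id ord).det ^ 2 * (M * Mᵀ).det =
      (bᵀ * b).det * (hᵀ * h).det := by
  set P := (fromCols (fromCols b t) s).submatrix id ord with hP
  -- `Q` is the orthogonal counterpart of `P`: its blocks `b`, `h`, `Mᵀ` are mutually orthogonal.
  -- Both `Pᵀ * Q` and `Qᵀ * Q` are therefore block triangular; comparing the square of the first
  -- determinant with the second eliminates `det Q`.
  set Q := (fromCols (fromCols b h) Mᵀ).submatrix id ord with hQ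
  have hhb : hᵀ * b = 0 := by simpa using congrArg transpose hbh
  have hbM : bᵀ * Mᵀ = 0 := by simpa using congrArg transpose hMb
  have hhM : hᵀ * Mᵀ = 0 := by simpa using congrArg transpose hMh
  have hsM : sᵀ * Mᵀ = 1 := by simpa using congrArg transpose hMs
  have hth : tᵀ * h = hᵀ * h := by
    rw [ht, transpose_add, transpose_mul, Matrix.add_mul, Matrix.mul_assoc, hbh]; simp
  have htM : tᵀ * Mᵀ = 0 := by
    rw [ht, transpose_add, transpose_mul, Matrix.add_mul, Matrix.mul_assoc, hbM, hhM]; simp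
  have e1 : (Pᵀ * Q).det = (bᵀ * b).det * (hᵀ * h).det := by
    have : Pᵀ * Q = (fromBlocks (fromBlocks (bᵀ * b) 0 (tᵀ * b) (hᵀ * h)) 0
        (sᵀ * fromCols b h) 1).submatrix ord ord := by
      rw [hP, hQ, transpose_submatrix, ← submatrix_mul _ _ _ id _ Function.bijective_id,
        transpose_fromCols, transpose_fromCols, fromRows_mul_fromCols, fromRows_mul_fromCols,
        fromRows_mul, hbM, htM, hbh, hth, hsM]
      congr 2
      ext i j
      rcases i with i | i <;> simp
    rw [this, det_submatrix_equiv_self, det_fromBlocks_zero₁₂, det_fromBlocks_zero₁₂, det_one,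
      mul_one]
  have e2 : (Qᵀ * Q).det = (bᵀ * b).det * (hᵀ * h).det * (M * Mᵀ).det := by
    have : Qᵀ * Q = (fromBlocks (fromBlocks (bᵀ * b) 0 0 (hᵀ * h)) 0
        (M * fromCols b h) (M * Mᵀ)).submatrix ord ord := by
      rw [hQ, transpose_submatrix, ← submatrix_mul _ _ _ id _ Function.bijective_id,
        transpose_fromCols, transpose_fromCols, fromRows_mul_fromCols, fromRows_mul_fromCols,
        fromRows_mul, hbM, hhM, hbh, hhb, transpose_transpose]
      congr 2
      ext i j
      rcases i with i | i <;> simp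
    rw [this, det_submatrix_equiv_self, det_fromBlocks_zero₁₂, det_fromBlocks_zero₁₂]
  rw [det_mul, det_transpose] at e1 e2
  have hne : (bᵀ * b).det * (hᵀ * h).det ≠ 0 := mul_ne_zero hb0 hh0
  refine mul_left_cancel₀ hne ?_
  calc _ = P.det ^ 2 * ((bᵀ * b).det * (hᵀ * h).det * (M * Mᵀ).det) := by ring
    _ = (P.det * Q.det) * (P.det * Q.det) := by rw [← e2]; ring
    _ = _ := by rw [e1]

/-- If `D = b * M` with linearly independent columns of `b`, then `det (bᵀ b) det (M Mᵀ)` only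
depends on `D`. -/
theorem det_gram_mul_det_gram_eq {m n α K : Type*} [Fintype m] [Fintype n] [Fintype α]
    [DecidableEq α] [CommRing K] {b b' : Matrix m α K} {M M' : Matrix α n K} (G : Matrix α α K)
    (hb : b = b' * G) (hM : M' = G * M) :
    (bᵀ * b).det * (M * Mᵀ).det = (b'ᵀ * b').det * (M' * M'ᵀ).det := by
  have h1 : bᵀ * b = Gᵀ * (b'ᵀ * b') * G := by
    rw [hb, transpose_mul]; simp only [Matrix.mul_assoc]
  have h2 : M' * M'ᵀ = G * (M * Mᵀ) * Gᵀ := by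
    rw [hM, transpose_mul]; simp only [Matrix.mul_assoc]
  rw [h1, h2]
  simp only [det_mul, det_transpose]
  ring

/-! ### Torsion of quotients and indices of sublattices. -/

/-- The preimage of the torsion subgroup is the saturation of `B` in `A`, so counting torsion
becomes computing an index. In the infinite case both sides take the value `0`. -/
theorem card_torsion_quotient {A : Type*} [AddCommGroup A] (B : Submodule ℤ A) :
    Nat.card (AddCommGroup.torsion (A ⧸ B)) =
      B.toAddSubgroup.relIndex ((AddCommGroup.torsion (A ⧸ B)).comap B.mkQ.toAddMonoidHom) := by
  have hker : B.mkQ.toAddMonoidHom.ker = B.toAddSubgroup := by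
    ext x
    simp
  rw [← hker, AddSubgroup.relIndex_ker, AddSubgroup.map_comap_eq_self_of_surjective]
  exact B.mkQ_surjective

theorem mem_comap_torsion {A : Type*} [AddCommGroup A] (B : Submodule ℤ A) (x : A) :
    x ∈ (AddCommGroup.torsion (A ⧸ B)).comap B.mkQ.toAddMonoidHom ↔ ∃ n : ℕ, 0 < n ∧ n • x ∈ B := by
  rw [AddSubgroup.mem_comap, AddCommGroup.mem_torsion, isOfFinAddOrder_iff_nsmul_eq_zero]
  refine exists_congr fun n => and_congr_right fun _ => ?_
  rw [← map_nsmul]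
  exact Submodule.Quotient.mk_eq_zero B

/-- The order of the torsion of a quotient by a sublattice of finite index. -/
theorem card_torsion_quotient_of_le {A : Type*} [AddCommGroup A] {B₁ B₂ : Submodule ℤ A}
    (h : B₁ ≤ B₂) (hi : B₁.toAddSubgroup.relIndex B₂.toAddSubgroup ≠ 0) :
    Nat.card (AddCommGroup.torsion (A ⧸ B₁)) =
      B₁.toAddSubgroup.relIndex B₂.toAddSubgroup * Nat.card (AddCommGroup.torsion (A ⧸ B₂)) := by
  -- A subgroup of finite index has the same saturation, so the claim is multiplicativity of the
  -- index along `B₁ ≤ B₂ ≤` saturation.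
  have heq : (AddCommGroup.torsion (A ⧸ B₁)).comap B₁.mkQ.toAddMonoidHom =
      (AddCommGroup.torsion (A ⧸ B₂)).comap B₂.mkQ.toAddMonoidHom := by
    ext x
    rw [mem_comap_torsion, mem_comap_torsion]
    constructor
    · rintro ⟨n, hn, hx⟩
      exact ⟨n, hn, h hx⟩
    · rintro ⟨n, hn, hx⟩
      obtain ⟨m, hm, -, hmx⟩ := AddSubgroup.exists_nsmul_mem_of_relIndex_ne_zero hi hx
      exact ⟨m * n, Nat.mul_pos hm hn, by rw [mul_smul]; exact hmx.1⟩
  rw [card_torsion_quotient, card_torsion_quotient, heq, AddSubgroup.relIndex_mul_relIndex]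
  · exact h
  · intro x hx
    rw [mem_comap_torsion]
    exact ⟨1, one_pos, by simpa using hx⟩

/-- The version for homology: `V` is the group of chains and `Z` that of cycles. Since `B₂ ≤ Z`, the
index is not changed by restriction to `Z`. -/
theorem card_torsion_quotient_submoduleOf {V : Type*} [AddCommGroup V] {B₁ B₂ Z : Submodule ℤ V}
    (h : B₁ ≤ B₂) (hZ : B₂ ≤ Z) (hi : B₁.toAddSubgroup.relIndex B₂.toAddSubgroup ≠ 0) :
    Nat.card (AddCommGroup.torsion (Z ⧸ B₁.submoduleOf Z)) =
      B₁.toAddSubgroup.relIndex B₂.toAddSubgroup *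
        Nat.card (AddCommGroup.torsion (Z ⧸ B₂.submoduleOf Z)) := by
  have h₁ : (B₁.submoduleOf Z).toAddSubgroup =
      B₁.toAddSubgroup.addSubgroupOf Z.toAddSubgroup := rfl
  have h₂ : (B₂.submoduleOf Z).toAddSubgroup =
      B₂.toAddSubgroup.addSubgroupOf Z.toAddSubgroup := rfl
  have hrel : (B₁.submoduleOf Z).toAddSubgroup.relIndex (B₂.submoduleOf Z).toAddSubgroup =
      B₁.toAddSubgroup.relIndex B₂.toAddSubgroup := by
    rw [h₁, h₂]
    exact AddSubgroup.relIndex_addSubgroupOf (H := B₁.toAddSubgroup) (K := B₂.toAddSubgroup)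
      (L := Z.toAddSubgroup) hZ
  have h₃ := card_torsion_quotient_of_le (B₁ := B₁.submoduleOf Z) (B₂ := B₂.submoduleOf Z)
    (Submodule.comap_mono h) (hrel ▸ hi)
  rw [hrel] at h₃
  exact h₃

/-- A finitely generated torsion group is finite, so `Nat.card` is the actual order; this permits
division by `θ_k`. -/
theorem card_torsion_ne_zero (A : Type*) [AddCommGroup A] [Module.Finite ℤ A] :
    Nat.card (AddCommGroup.torsion A) ≠ 0 := by
  have : Module.Finite ℤ (AddCommGroup.torsion A).toIntSubmodule := inferInstance
  have : Finite (AddCommGroup.torsion A).toIntSubmodule := by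
    refine Module.finite_of_fg_torsion _ ?_
    rintro ⟨x, hx⟩
    obtain ⟨n, hn, h⟩ := isOfFinAddOrder_iff_nsmul_eq_zero.1 ((AddCommGroup.mem_torsion _).1 hx)
    refine ⟨⟨(n : ℤ), mem_nonZeroDivisors_of_ne_zero (by exact_mod_cast hn.ne')⟩, ?_⟩
    ext
    simpa [Submonoid.smul_def] using h
  exact (Nat.card_pos (α := (AddCommGroup.torsion A).toIntSubmodule)).ne'

/-- The index of a sublattice is the determinant of the change of bases. -/
theorem relIndex_eq_natAbs_det {V ι : Type*} [AddCommGroup V] [Fintype ι] [DecidableEq ι]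
    {L₁ L₂ : Submodule ℤ V} (h : L₁ ≤ L₂) (b₁ : Basis ι ℤ L₁) (b₂ : Basis ι ℤ L₂)
    (N : Matrix ι ι ℤ) (hN : ∀ i j, b₂.repr ⟨b₁ j, h (b₁ j).2⟩ i = N i j) :
    L₁.toAddSubgroup.relIndex L₂.toAddSubgroup = N.det.natAbs := by
  refine (AddSubgroup.relIndex_eq_natAbs_det L₁.toAddSubgroup L₂.toAddSubgroup h b₁ b₂).trans ?_
  refine congrArg (fun M : Matrix ι ι ℤ => M.det.natAbs) ?_
  ext i j
  exact hN i j

/-! ### Cellular chains, cycles and boundaries. -/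

section Cellular

variable {X : Type u} [TopologicalSpace X] [T2Space X] {C : Set X} [Topology.CWComplex C]
  [Topology.CWComplex.Finite C]

theorem boundary_single (o : CellOrientation C) (A : Type) [CommRing A] (n : ℕ)
    [DecidableEq (cell C (n + 1))] (e : cell C (n + 1)) (f : cell C n) :
    boundary o A n (Pi.single e 1) f = (incidence o n f e : A) := by
  simp [boundary]

theorem realChain_boundary_single (o : CellOrientation C) (n : ℕ)
    [DecidableEq (cell C (n + 1))] (e : cell C (n + 1)) :
    realChain n (boundary o ℤ n (Pi.single e 1)) = boundary o ℝ n (Pi.single e 1) := by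
  ext f
  rw [boundary_single]
  change ((boundary o ℤ n (Pi.single e 1) f : ℤ) : ℝ) = _
  rw [boundary_single]
  simp

/-- Makes visible that the boundaries in degree `n` depend on `I` only through its `(n+1)`-cells. -/
theorem boundaries_eq_span (o : CellOrientation C) (A : Type) [CommRing A]
    (I : ∀ n, Set (cell C n)) (n : ℕ) [DecidableEq (cell C (n + 1))] :
    boundaries o A I n =
      Submodule.span A ((fun e => boundary o A n (Pi.single e 1)) '' I (n + 1)) := by
  apply le_antisymm
  · rintro _ ⟨c, hc, rfl⟩
    rw [← Finset.univ_sum_single c, map_sum]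
    refine Submodule.sum_mem _ fun e _ => ?_
    by_cases he : e ∈ I (n + 1)
    · have : (Pi.single e (c e) : cell C (n + 1) → A) = c e • Pi.single e 1 := by
        rw [← Pi.single_smul, smul_eq_mul, mul_one]
      rw [this, map_smul]
      exact Submodule.smul_mem _ _ (Submodule.subset_span ⟨e, he, rfl⟩)
    · rw [hc e he, Pi.single_zero, map_zero]
      exact Submodule.zero_mem _
  · rw [Submodule.span_le]
    rintro _ ⟨e, he, rfl⟩
    refine ⟨Pi.single e 1, fun e' he' => Pi.single_eq_of_ne ?_ _, rfl⟩
    rintro rfl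
    exact he' he

theorem mem_chains_allCells (A : Type) [CommRing A] (n : ℕ) (c : cell C n → A) :
    c ∈ chains A (allCells C) n :=
  fun e he => (he (Set.mem_univ e)).elim

theorem boundary_mem_boundaries (o : CellOrientation C) (A : Type) [CommRing A] (n : ℕ)
    (c : cell C (n + 1) → A) : boundary o A n c ∈ boundaries o A (allCells C) n :=
  ⟨c, mem_chains_allCells A _ c, rfl⟩

theorem boundaries_mono (o : CellOrientation C) (A : Type) [CommRing A]
    (I : ∀ n, Set (cell C n)) (n : ℕ) :
    boundaries o A I n ≤ boundaries o A (allCells C) n := by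
  rintro _ ⟨c, -, rfl⟩
  exact boundary_mem_boundaries o A n c

theorem mem_cycles_allCells_succ (o : CellOrientation C) (A : Type) [CommRing A] (n : ℕ)
    (c : cell C (n + 1) → A) :
    c ∈ cycles o A (allCells C) (n + 1) ↔ boundary o A n c = 0 :=
  ⟨fun h => h.2, fun h => ⟨mem_chains_allCells A _ c, h⟩⟩

theorem boundaries_le_cycles (o : CellOrientation C) (A : Type) [CommRing A] (n : ℕ) :
    boundaries o A (allCells C) n ≤ cycles o A (allCells C) n := by
  rintro _ ⟨c, -, rfl⟩
  cases n with
  | zero => exact mem_chains_allCells A _ _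
  | succ n => exact (mem_cycles_allCells_succ o A n _).2 (boundary_boundary o A n c)

/-! ### Coordinates of the boundary operator -/

/-- The boundary operator in the coordinates given by a basis of the boundaries. -/
noncomputable def boundaryCoords {o : CellOrientation C} {A : Type} [CommRing A] {n : ℕ}
    {ι : Type*} [Fintype ι] (b : Basis ι A (boundaries o A (allCells C) n)) :
    (cell C (n + 1) → A) →ₗ[A] (ι → A) :=
  b.equivFun.toLinearMap ∘ₗ LinearMap.codRestrict _ (boundary o A n) (boundary_mem_boundaries o A n)

theorem sum_boundaryCoords {o : CellOrientation C} {A : Type} [CommRing A] {n : ℕ}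
    {ι : Type*} [Fintype ι] (b : Basis ι A (boundaries o A (allCells C) n))
    (c : cell C (n + 1) → A) :
    ∑ i, boundaryCoords b c i • (b i : cell C n → A) = boundary o A n c := by
  have h := congrArg Subtype.val (b.sum_equivFun
    (⟨boundary o A n c, boundary_mem_boundaries o A n c⟩ : boundaries o A (allCells C) n))
  rwa [Submodule.coe_sum] at h

theorem boundaryCoords_eq_zero_iff {o : CellOrientation C} {A : Type} [CommRing A] {n : ℕ}
    {ι : Type*} [Fintype ι] (b : Basis ι A (boundaries o A (allCells C) n))
    (c : cell C (n + 1) → A) : boundaryCoords b c = 0 ↔ boundary o A n c = 0 := by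
  simp only [boundaryCoords, LinearMap.comp_apply, LinearEquiv.coe_coe,
    LinearEquiv.map_eq_zero_iff]
  exact Subtype.ext_iff

open Classical in
/-- The matrix of the boundary operator in a basis of the boundaries. -/
noncomputable def boundaryMatrix {o : CellOrientation C} {A : Type} [CommRing A] {n : ℕ}
    {ι : Type*} [Fintype ι] (b : Basis ι A (boundaries o A (allCells C) n)) :
    Matrix ι (cell C (n + 1)) A :=
  LinearMap.toMatrix' (boundaryCoords b)

theorem boundaryMatrix_mulVec {o : CellOrientation C} {A : Type} [CommRing A] {n : ℕ}
    {ι : Type*} [Fintype ι] (b : Basis ι A (boundaries o A (allCells C) n))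
    (c : cell C (n + 1) → A) : boundaryMatrix b *ᵥ c = boundaryCoords b c := by
  classical
  exact LinearMap.toMatrix'_mulVec _ _

/-- The matrix whose columns are the given chains. -/
def chainMatrix {A ι : Type*} {n : ℕ} (v : ι → cell C n → A) : Matrix (cell C n) ι A :=
  Matrix.of fun e i => v i e

theorem boundaryMatrix_mul_chainMatrix {o : CellOrientation C} {A : Type} [CommRing A] {n : ℕ}
    {ι κ : Type*} [Fintype ι] (b : Basis ι A (boundaries o A (allCells C) n))
    (v : κ → cell C (n + 1) → A) (i : ι) (j : κ) :
    (boundaryMatrix b * chainMatrix v) i j = boundaryCoords b (v j) i := by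
  rw [← boundaryMatrix_mulVec]
  rfl

/-! ### Gram determinants -/

theorem gram_chains {n : ℕ} {ι : Type*} (v : ι → EuclideanChains C n) :
    Matrix.gram ℝ v = (chainMatrix fun i => (v i : EuclideanChains C n).ofLp)ᵀ *
      chainMatrix fun i => (v i).ofLp := by
  ext i j
  simp [Matrix.gram, Matrix.mul_apply, PiLp.inner_apply, chainMatrix, mul_comm]

theorem det_chainMatrix_gram_ne_zero {n : ℕ} {ι : Type*} [Fintype ι] [DecidableEq ι]
    (v : ι → cell C n → ℝ) (hv : LinearIndependent ℝ v) :
    ((chainMatrix v)ᵀ * chainMatrix v).det ≠ 0 := by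
  have h := gram_chains (fun i => toEuclidean n (v i))
  have h' : LinearIndependent ℝ (fun i => toEuclidean n (v i)) :=
    hv.map' (toEuclidean n).toLinearMap (LinearEquiv.ker _)
  have h2 := Matrix.det_gram_ne_zero_iff_linearIndependent.2 h'
  rw [h] at h2
  exact h2

/-! ### Harmonic representatives -/

theorem toEuclidean_mem_boundarySpace {o : CellOrientation C} {n : ℕ} {c : cell C n → ℝ} :
    toEuclidean n c ∈ boundarySpace o n ↔ c ∈ boundaries o ℝ (allCells C) n :=
  (Submodule.mem_map_equiv (e := toEuclidean n) _).trans Iff.rfl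

theorem toEuclidean_mem_cycles {o : CellOrientation C} {n : ℕ} {x : EuclideanChains C n} :
    x ∈ (cycles o ℝ (allCells C) n).map (toEuclidean n).toLinearMap ↔
      x.ofLp ∈ cycles o ℝ (allCells C) n :=
  (Submodule.mem_map_equiv (e := toEuclidean n) _).trans Iff.rfl

theorem mk_eq_mk_iff {o : CellOrientation C} {n : ℕ} (x y : cycles o ℝ (allCells C) n) :
    (Submodule.Quotient.mk x : Homology o ℝ (allCells C) n) = Submodule.Quotient.mk y ↔
      (x : cell C n → ℝ) - y ∈ boundaries o ℝ (allCells C) n :=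
  Submodule.Quotient.eq _

/-- Injective because a boundary orthogonal to all boundaries vanishes. Surjective because
projecting a cycle off `B_n` changes it by a boundary, which leaves it a cycle in the same class. -/
theorem harmonicToHomology_bijective (o : CellOrientation C) (n : ℕ) :
    Function.Bijective (harmonicToHomology o n) := by
  constructor
  · rw [← LinearMap.ker_eq_bot, Submodule.eq_bot_iff]
    intro x hx
    have hx' : (x : EuclideanChains C n).ofLp ∈ boundaries o ℝ (allCells C) n := by
      have h0 : (Submodule.Quotient.mk ⟨_, harmonicSpace_cycle o n x⟩ :
          Homology o ℝ (allCells C) n) = Submodule.Quotient.mk 0 := LinearMap.mem_ker.1 hx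
      simpa using (mk_eq_mk_iff _ _).1 h0
    have h1 : (x : EuclideanChains C n) ∈ boundarySpace o n :=
      toEuclidean_mem_boundarySpace.2 hx'
    have h2 := x.2.2 _ h1
    exact Subtype.ext (inner_self_eq_zero.1 h2)
  · intro y
    obtain ⟨z, rfl⟩ := Submodule.Quotient.mk_surjective _ y
    obtain ⟨p, hp, q, hq, hpq⟩ := (boundarySpace o n).exists_add_mem_mem_orthogonal
      (toEuclidean n (z : cell C n → ℝ))
    have hp' : p.ofLp ∈ boundaries o ℝ (allCells C) n := toEuclidean_mem_boundarySpace.1 hp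
    have hq' : q.ofLp = (z : cell C n → ℝ) - p.ofLp := by
      have := congrArg WithLp.ofLp hpq
      rw [WithLp.ofLp_add] at this
      rw [eq_sub_iff_add_eq', ← this]
      rfl
    have hqz : q.ofLp ∈ cycles o ℝ (allCells C) n := by
      rw [hq']
      exact Submodule.sub_mem _ z.2 (boundaries_le_cycles o ℝ n hp')
    refine ⟨⟨q, toEuclidean_mem_cycles.2 hqz, hq⟩, ?_⟩
    refine (mk_eq_mk_iff (o := o) ⟨q.ofLp, hqz⟩ z).2 ?_
    change q.ofLp - (z : cell C n → ℝ) ∈ _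
    rw [hq', sub_sub_cancel_left]
    exact Submodule.neg_mem _ hp'

/-- The harmonic representatives of a homology basis. -/
noncomputable def harmonicBasis {o : CellOrientation C} (h : HomologyBasis o) (n : ℕ) :
    Basis (Fin (betti o (allCells C) n)) ℝ (harmonicSpace o n) :=
  (h n).map (LinearEquiv.ofBijective _ (harmonicToHomology_bijective o n)).symm

theorem harmonicToHomology_harmonicBasis {o : CellOrientation C} (h : HomologyBasis o) (n : ℕ)
    (i : Fin (betti o (allCells C) n)) :
    harmonicToHomology o n (harmonicBasis h n i) = h n i := by
  rw [harmonicBasis, Basis.map_apply]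
  exact LinearEquiv.apply_symm_apply
    (LinearEquiv.ofBijective _ (harmonicToHomology_bijective o n)) _

theorem harmonicBasis_linearIndependent {o : CellOrientation C} (h : HomologyBasis o) (n : ℕ) :
    LinearIndependent ℝ fun i => (harmonicBasis h n i : EuclideanChains C n).ofLp :=
  (linearIndependent_coe_basis (harmonicBasis h n)).map' (toEuclidean n).symm.toLinearMap
    (LinearEquiv.ker _)

/-- Combinatoriality enters here: it makes the harmonic representatives of `h n` a `ℤ`-basis of the
lattice whose covolume defines `eta`. -/
theorem eta_eq_det {o : CellOrientation C} (h : HomologyBasis o) (hh : IsCombinatorial o h)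
    (n : ℕ) : eta o n =
      ((chainMatrix fun i => (harmonicBasis h n i : EuclideanChains C n).ofLp)ᵀ *
        chainMatrix fun i => (harmonicBasis h n i : EuclideanChains C n).ofLp).det := by
  have hL : (homologyLattice o n).comap ((harmonicToHomology o n).restrictScalars ℤ) =
      Submodule.span ℤ (Set.range (harmonicBasis h n)) := by
    apply Submodule.map_injective_of_injective
      (f := (harmonicToHomology o n).restrictScalars ℤ) (harmonicToHomology_bijective o n).1
    rw [Submodule.map_comap_eq_of_surjective (f := (harmonicToHomology o n).restrictScalars ℤ)
        (harmonicToHomology_bijective o n).2,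
      Submodule.map_span, ← Set.range_comp, ← hh n]
    congr 2
    ext i
    exact (harmonicToHomology_harmonicBasis h n i).symm
  rw [eta, hL, covolume_span_range_sq, ← gram_chains]
  rfl

/-! ### The squared determinants in the torsion -/

/-- The matrix of `∂ : C_n → B_{n-1}` in the chosen basis of `B_{n-1}`. -/
noncomputable def prevMatrix {o : CellOrientation C} (D : TorsionChoices o) :
    ∀ n, Matrix (Fin (prevRank o n)) (cell C n) ℝ
  | 0 => Matrix.of fun i => i.elim0
  | n + 1 => boundaryMatrix (D.b n)

theorem prevMatrix_mulVec_cycle {o : CellOrientation C} (D : TorsionChoices o) (n : ℕ)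
    {c : cell C n → ℝ} (hc : c ∈ cycles o ℝ (allCells C) n) : prevMatrix D n *ᵥ c = 0 := by
  cases n with
  | zero => ext i; exact i.elim0
  | succ n => exact (boundaryMatrix_mulVec _ c).trans ((boundaryCoords_eq_zero_iff _ _).2 hc.2)

theorem prevMatrix_mul_liftedBasis {o : CellOrientation C} (D : TorsionChoices o) (n : ℕ) :
    prevMatrix D n * chainMatrix (liftedBasis D n) = 1 := by
  cases n with
  | zero => ext i; exact i.elim0
  | succ n =>
    ext i j
    refine (boundaryMatrix_mul_chainMatrix (D.b n) _ i j).trans ?_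
    have : boundaryCoords (D.b n) (liftedBasis D (n + 1) j) = (D.b n).equivFun (D.b n j) := by
      refine congrArg (D.b n).equivFun (Subtype.ext ?_)
      exact D.s_spec n _
    rw [this]
    refine ((D.b n).equivFun_self j i).trans ?_
    rw [Matrix.one_apply]
    by_cases hij : j = i
    · exact (if_pos hij).trans (if_pos hij.symm).symm
    · exact (if_neg hij).trans (if_neg fun e => hij e.symm).symm

-- The lift `D.t n (h n j)` differs from the harmonic representative of the same class by a
-- boundary, which is what `det_adapted_basis_sq` allows. Cycles are killed by `prevMatrix`, and the
-- lifts of the basis of `B_{n-1}` are dual to its rows.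
open Classical in
theorem det_changeOfBasis_sq {o : CellOrientation C} (h : HomologyBasis o)
    (hh : IsCombinatorial o h) (D : TorsionChoices o) (n : ℕ) :
    (changeOfBasis h D n).det ^ 2 * (prevMatrix D n * (prevMatrix D n)ᵀ).det =
      ((chainMatrix fun i => (D.b n i : cell C n → ℝ))ᵀ *
        chainMatrix fun i => (D.b n i : cell C n → ℝ)).det * eta o n := by
  set H : Fin (betti o (allCells C) n) → cell C n → ℝ :=
    fun i => (harmonicBasis h n i : EuclideanChains C n).ofLp with hH
  have hHc : ∀ i, H i ∈ cycles o ℝ (allCells C) n := fun i =>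
    toEuclidean_mem_cycles.1 (harmonicBasis h n i).2.1
  have hlinb := linearIndependent_coe_basis (D.b n)
  have hlinH : LinearIndependent ℝ H := harmonicBasis_linearIndependent h n
  have hdiff : ∀ j, (D.t n (h n j) : cell C n → ℝ) - H j ∈ boundaries o ℝ (allCells C) n := by
    intro j
    refine (mk_eq_mk_iff (o := o) (D.t n (h n j)) ⟨H j, hHc j⟩).1 ?_
    exact (D.t_spec n _).trans (harmonicToHomology_harmonicBasis h n j).symm
  rw [eta_eq_det h hh, ← det_adapted_basis_sq (D.ord n)
    (chainMatrix fun i => (D.b n i : cell C n → ℝ))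
    (chainMatrix fun i => (D.t n (h n i) : cell C n → ℝ)) (chainMatrix H)
    (chainMatrix (liftedBasis D n)) (prevMatrix D n)
    -- The coordinates, in the basis of `B_n`, of the difference between the chosen lift and the
    -- harmonic representative.
    (Matrix.of fun i j => (D.b n).equivFun ⟨_, hdiff j⟩ i)]
  · congr 3
    ext e f
    simp only [changeOfBasis, newBasis, of_apply, submatrix_apply, id_eq]
    rcases D.ord n f with (i | i) | i <;> rfl
  · ext i j
    have h1 : toEuclidean n (D.b n i : cell C n → ℝ) ∈ boundarySpace o n :=
      toEuclidean_mem_boundarySpace.2 (D.b n i).2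
    have h2 := (harmonicBasis h n j).2.2 _ h1
    simpa [Matrix.mul_apply, PiLp.inner_apply, chainMatrix, mul_comm, hH] using h2
  · ext i j
    exact congrFun (prevMatrix_mulVec_cycle D n (boundaries_le_cycles o ℝ n (D.b n j).2)) i
  · ext i j
    exact congrFun (prevMatrix_mulVec_cycle D n (hHc j)) i
  · exact prevMatrix_mul_liftedBasis D n
  · ext e j
    have h1 := congrFun (congrArg Subtype.val ((D.b n).sum_equivFun ⟨_, hdiff j⟩)) e
    rw [Submodule.coe_sum, Finset.sum_apply] at h1
    simp only [Matrix.add_apply, mul_apply, chainMatrix, of_apply]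
    rw [← sub_eq_iff_eq_add']
    refine h1.symm.trans (Finset.sum_congr rfl fun i _ => ?_)
    simp [mul_comm]
  · exact det_chainMatrix_gram_ne_zero _ hlinb
  · exact det_chainMatrix_gram_ne_zero _ hlinH

/-! ### Integral bases of the boundaries -/

theorem realChain_linearIndependent {n : ℕ} {ι : Type*} {v : ι → cell C n → ℤ}
    (hv : LinearIndependent ℤ v) : LinearIndependent ℝ fun i => realChain n (v i) := by
  have e : (fun i => realChain n (v i)) = fun i => algebraMap ℤ ℝ ∘ v i := rfl
  rw [e, linearIndependent_algebraMap_comp_iff]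
  exact hv

/-- The real boundaries are spanned by the boundaries of cells, and these are integral, hence
already in the `ℤ`-span of `b`. -/
theorem span_realChain_boundaries (o : CellOrientation C) (n : ℕ) {ι : Type*}
    (b : Basis ι ℤ (boundaries o ℤ (allCells C) n)) :
    Submodule.span ℝ (Set.range fun i => realChain n (b i : cell C n → ℤ)) =
      boundaries o ℝ (allCells C) n := by
  classical
  apply le_antisymm
  · rw [Submodule.span_le]
    rintro _ ⟨i, rfl⟩
    exact realChain_mem_boundaries o _ n (b i).2
  · rw [boundaries_eq_span, Submodule.span_le]
    rintro _ ⟨e, -, rfl⟩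
    change boundary o ℝ n (Pi.single e 1) ∈ _
    rw [← realChain_boundary_single]
    have h1 := b.mem_span ⟨_, boundary_mem_boundaries o ℤ n (Pi.single e 1)⟩
    have h2 := Submodule.mem_map_of_mem (f := realChain n ∘ₗ Submodule.subtype _) h1
    rw [Submodule.map_span, ← Set.range_comp] at h2
    exact Submodule.span_subset_span ℤ ℝ _ h2

/-- The real basis of the boundaries given by an integral one. -/
noncomputable def realBasis {o : CellOrientation C} {n : ℕ} {ι : Type*}
    (b : Basis ι ℤ (boundaries o ℤ (allCells C) n)) :
    Basis ι ℝ (boundaries o ℝ (allCells C) n) :=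
  (Basis.span (realChain_linearIndependent
    (linearIndependent_coe_basis b))).map
    (LinearEquiv.ofEq _ _ (span_realChain_boundaries o n b))

theorem coe_realBasis {o : CellOrientation C} {n : ℕ} {ι : Type*}
    (b : Basis ι ℤ (boundaries o ℤ (allCells C) n)) (i : ι) :
    (realBasis b i : cell C n → ℝ) = realChain n (b i) := by
  simp only [realBasis, Basis.map_apply]
  rw [Basis.span_apply]
  rfl

/-- The index type is that of `TorsionChoices.b`, so that an integral basis can be compared with the
chosen real one through a square matrix. -/
theorem exists_integral_basis (o : CellOrientation C) (n : ℕ) :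
    Nonempty (Basis (Fin (finrank ℝ (boundaries o ℝ (allCells C) n))) ℤ
      (boundaries o ℤ (allCells C) n)) := by
  let b := Module.finBasis ℤ (boundaries o ℤ (allCells C) n)
  have h := Module.finrank_eq_card_basis (realBasis b)
  rw [Fintype.card_fin] at h
  rw [h]
  exact ⟨b⟩

/-- Uniqueness of coordinates: the integral ones also express the boundary in the real basis. Minors
of the real matrix are thus integers. -/
theorem boundaryMatrix_realBasis {o : CellOrientation C} {n : ℕ} {ι : Type*} [Fintype ι]
    (b : Basis ι ℤ (boundaries o ℤ (allCells C) n)) :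
    boundaryMatrix (realBasis b) = (boundaryMatrix b).map (Int.cast : ℤ → ℝ) := by
  classical
  ext i e
  have h : boundaryCoords (realBasis b) (Pi.single e 1) =
      fun i => (boundaryCoords b (Pi.single e 1) i : ℝ) := by
    refine ((realBasis b).equivFun.eq_symm_apply).1 (Subtype.ext ?_)
    rw [Basis.equivFun_symm_apply, Submodule.coe_sum]
    change boundary o ℝ n (Pi.single e 1) = _
    rw [← realChain_boundary_single, ← sum_boundaryCoords b, map_sum]
    refine Finset.sum_congr rfl fun i _ => ?_
    rw [Submodule.coe_smul, coe_realBasis, map_smul]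
    exact (Int.cast_smul_eq_zsmul ℝ _ _).symm
  rw [map_apply]
  have h1 := congrFun h i
  rw [← boundaryMatrix_mulVec, ← boundaryMatrix_mulVec, mulVec_single_one, mulVec_single_one] at h1
  exact h1

theorem mu_eq_det {o : CellOrientation C} {n : ℕ} {ι : Type*} [Fintype ι] [DecidableEq ι]
    (b : Basis ι ℤ (boundaries o ℤ (allCells C) n)) :
    mu o n = ((chainMatrix fun i => (realBasis b i : cell C n → ℝ))ᵀ *
      chainMatrix fun i => (realBasis b i : cell C n → ℝ)).det := by
  let e : boundaries o ℝ (allCells C) n ≃ₗ[ℝ] boundarySpace o n :=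
    (toEuclidean n).submoduleMap (boundaries o ℝ (allCells C) n)
  have he : ∀ x, (e x : EuclideanChains C n) = toEuclidean n (x : cell C n → ℝ) := fun _ => rfl
  -- The two lattices are compared after injecting them into `C_n(X; ℝ)`, where each is a `ℤ`-span
  -- of explicit chains.
  let φ : boundarySpace o n →ₗ[ℤ] (cell C n → ℝ) :=
    ((toEuclidean n).symm.toLinearMap ∘ₗ (boundarySpace o n).subtype).restrictScalars ℤ
  have hφ : Function.Injective φ :=
    (toEuclidean n).symm.injective.comp Subtype.val_injective
  have hφe : ∀ x, φ (e x) = x := fun _ => rfl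
  have hL : boundaryLattice o n =
      Submodule.span ℤ (Set.range ((realBasis b).map e)) := by
    apply Submodule.map_injective_of_injective hφ
    have hle : (boundaries o ℤ (allCells C) n).map (realChain n) ≤ LinearMap.range φ := by
      rintro _ ⟨c, hc, rfl⟩
      exact ⟨e ⟨_, realChain_mem_boundaries o _ n hc⟩, hφe _⟩
    change Submodule.map φ (Submodule.comap φ _) = _
    rw [Submodule.map_comap_eq_self hle, Submodule.map_span, ← Set.range_comp]
    have h1 := congrArg (Submodule.map (boundaries o ℤ (allCells C) n).subtype) b.span_eq
    rw [Submodule.map_subtype_top] at h1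
    rw [← h1, Submodule.map_span, Submodule.map_span, ← Set.range_comp, ← Set.range_comp]
    congr 2
    ext1 i
    exact ((congrArg φ (Basis.map_apply _ _ _)).trans
      ((hφe _).trans (coe_realBasis b i))).symm
  rw [mu, hL, covolume_span_range_sq]
  have := gram_chains fun i => (((realBasis b).map e i : boundarySpace o n) : EuclideanChains C n)
  refine (congrArg Matrix.det this).trans ?_
  rfl

/-! ### Independence of the basis of the boundaries -/

/-- Changing the basis by `G` acts on the columns spanning `B_n` and inversely on the coordinates of
`∂`; both sides acquire the same factor `det G ^ 2`. -/
theorem det_gram_mul_det_boundaryMatrix_eq {o : CellOrientation C} {n : ℕ} {ι : Type*} [Fintype ι]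
    [DecidableEq ι] (b b' : Basis ι ℝ (boundaries o ℝ (allCells C) n)) :
    ((chainMatrix fun i => (b i : cell C n → ℝ))ᵀ *
        chainMatrix fun i => (b i : cell C n → ℝ)).det *
        (boundaryMatrix b * (boundaryMatrix b)ᵀ).det =
      ((chainMatrix fun i => (b' i : cell C n → ℝ))ᵀ *
        chainMatrix fun i => (b' i : cell C n → ℝ)).det *
        (boundaryMatrix b' * (boundaryMatrix b')ᵀ).det := by
  classical
  refine det_gram_mul_det_gram_eq (b'.toMatrix b) ?_ ?_
  · ext e i
    have h1 := congrFun (congrArg Subtype.val (b'.sum_repr (b i))) e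
    rw [Submodule.coe_sum, Finset.sum_apply] at h1
    simp only [mul_apply, chainMatrix, of_apply]
    refine h1.symm.trans (Finset.sum_congr rfl fun j _ => ?_)
    simp [mul_comm, Basis.toMatrix_apply]
  · ext i e
    have h1 := congrFun (b.toMatrix_mulVec_repr b'
      ⟨_, boundary_mem_boundaries o ℝ n (Pi.single e 1)⟩) i
    have h2 := congrFun (boundaryMatrix_mulVec b' (Pi.single e 1)) i
    rw [mulVec_single_one] at h2
    refine h2.trans (h1.symm.trans ?_)
    rw [mul_apply, mulVec, dotProduct]
    refine Finset.sum_congr rfl fun j _ => ?_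
    have h3 := congrFun (boundaryMatrix_mulVec b (Pi.single e 1)) j
    rw [mulVec_single_one] at h3
    exact congrArg _ h3.symm

/-! ### Minors of the boundary matrix -/

section Minors

variable {o : CellOrientation C} {n : ℕ} {ι : Type*} [Fintype ι] [DecidableEq ι]

-- The columns of the minor are the coordinates of the boundaries of the selected cells.
open Classical in
theorem linearIndependent_of_minor_ne_zero (b : Basis ι ℤ (boundaries o ℤ (allCells C) n))
    {f : ι → cell C (n + 1)} (hd : ((boundaryMatrix b).submatrix id f).det ≠ 0) :
    LinearIndependent ℤ fun i => boundary o ℤ n (Pi.single (f i) 1) := by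
  have h1 := Matrix.linearIndependent_cols_of_det_ne_zero hd
  let ψ : (ι → ℤ) →ₗ[ℤ] (cell C n → ℤ) := Submodule.subtype _ ∘ₗ b.equivFun.symm.toLinearMap
  have h2 := h1.map' ψ (LinearMap.ker_eq_bot.2
    (Subtype.val_injective.comp b.equivFun.symm.injective))
  have h3 : (fun i => boundary o ℤ n (Pi.single (f i) 1)) =
      ψ ∘ ((boundaryMatrix b).submatrix id f).col := by
    ext1 i
    have : ((boundaryMatrix b).submatrix id f).col i = boundaryCoords b (Pi.single (f i) 1) := by
      rw [← boundaryMatrix_mulVec, mulVec_single_one]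
      rfl
    rw [Function.comp_apply, this]
    exact (congrArg Subtype.val (b.equivFun.symm_apply_apply
      ⟨_, boundary_mem_boundaries o ℤ n (Pi.single (f i) 1)⟩)).symm
  rw [h3]
  exact h2

-- The boundaries of the selected cells form a `ℤ`-basis of the smaller lattice, and the submatrix
-- is the change of basis to `b`.
open Classical in
theorem relIndex_boundaries (b : Basis ι ℤ (boundaries o ℤ (allCells C) n))
    {f : ι → cell C (n + 1)} (hd : ((boundaryMatrix b).submatrix id f).det ≠ 0)
    {I : ∀ n, Set (cell C n)} (hI : I (n + 1) = Set.range f) :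
    (boundaries o ℤ I n).toAddSubgroup.relIndex (boundaries o ℤ (allCells C) n).toAddSubgroup =
      ((boundaryMatrix b).submatrix id f).det.natAbs := by
  have hspan : boundaries o ℤ I n =
      Submodule.span ℤ (Set.range fun i => boundary o ℤ n (Pi.single (f i) 1)) := by
    rw [boundaries_eq_span, hI, ← Set.range_comp]
    rfl
  let c : Basis ι ℤ (boundaries o ℤ I n) :=
    (Basis.span (linearIndependent_of_minor_ne_zero b hd)).map (LinearEquiv.ofEq _ _ hspan.symm)
  have hc : ∀ i, (c i : cell C n → ℤ) = boundary o ℤ n (Pi.single (f i) 1) := fun i => by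
    simp only [c, Basis.map_apply, LinearEquiv.coe_ofEq_apply]
    rw [Basis.span_apply]
  refine relIndex_eq_natAbs_det (boundaries_mono o ℤ I n) c b _ fun i j => ?_
  have h2 := congrFun (boundaryMatrix_mulVec b (Pi.single (f j) 1)) i
  rw [mulVec_single_one] at h2
  refine Eq.trans ?_ h2.symm
  exact DFunLike.congr_fun (congrArg b.repr (Subtype.ext (hc j))) i

end Minors

/-! ### Subcomplexes and their cells -/

/-- The open cell of a cell outside `T` is nonempty and disjoint from `T`. Inclusions of
subcomplexes can thus be tested on cells. -/
theorem mem_subcomplex_iff (T : Subcomplex C) (n : ℕ) (e : cell C n) :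
    e ∈ T.I n ↔ openCell n e ⊆ (T : Set X) := by
  refine ⟨fun h => T.openCell_subset_of_mem h, fun h => ?_⟩
  by_contra he
  have hd := T.disjoint_openCell_subcomplex_of_not_mem he
  obtain ⟨x, hx⟩ := openCell_nonempty n e
  exact Set.disjoint_left.1 hd hx (h hx)

theorem subcomplex_le_iff (S T : Subcomplex C) : S ≤ T ↔ ∀ n, S.I n ⊆ T.I n := by
  constructor
  · intro h n e he
    rw [mem_subcomplex_iff] at he ⊢
    exact he.trans h
  · intro h
    change (S : Set X) ⊆ T
    rw [← Topology.CWComplex.Subcomplex.union (E := S)]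
    refine Set.iUnion_subset fun n => Set.iUnion_subset fun e => ?_
    exact (mem_subcomplex_iff T n e).1 (h n e.2)

theorem mem_skeleton_I (k : ℕ) (n : ℕ) (e : cell C n) :
    e ∈ (skeleton C (k : ℕ∞)).I n ↔ n ≤ k := by
  rw [skeleton, skeletonLT_I, Set.mem_ofPred_eq, ← Nat.cast_succ, Nat.cast_lt, Nat.lt_succ_iff]

/-- The cells of the union of the `k`-skeleton with a set of `(k+1)`-cells. -/
def skeletonCells (k : ℕ) (S : Set (cell C (k + 1))) (n : ℕ) : Set (cell C n) :=
  {e | n ≤ k ∨ ∃ h : n = k + 1, h ▸ e ∈ S}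

theorem skeletonCells_succ (k : ℕ) (S : Set (cell C (k + 1))) :
    skeletonCells k S (k + 1) = S := by
  ext e
  simp [skeletonCells]

theorem skeletonCells_of_le {k n : ℕ} (h : n ≤ k) (S : Set (cell C (k + 1))) :
    skeletonCells k S n = Set.univ := by
  ext e
  simp [skeletonCells, h]

theorem skeletonCells_of_lt {k n : ℕ} (h : k + 1 < n) (S : Set (cell C (k + 1))) :
    skeletonCells k S n = ∅ := by
  ext e
  simp only [skeletonCells, Set.mem_ofPred_eq, Set.mem_empty_iff_false, iff_false, not_or,
    not_exists]
  exact ⟨by omega, by omega⟩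

variable (C) in
/-- The union of the `k`-skeleton with a set of `(k+1)`-cells. -/
def skeletonUnion (k : ℕ) (S : Set (cell C (k + 1))) : Subcomplex C :=
  Topology.CWComplex.Subcomplex.mk' C (⋃ (n : ℕ) (j : skeletonCells k S n), openCell n j.1)
    (skeletonCells k S)
    (by
      rintro n ⟨e, he⟩ x hx
      rw [← cellFrontier_union_openCell_eq_closedCell] at hx
      rcases hx with hx | hx
      -- The frontier of an `n`-cell with `n ≤ k + 1` meets only open cells of dimension less than
      -- `n`, hence at most `k`, and all of these are present.
      · have hn : n ≤ k + 1 := by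
          rcases he with h | ⟨h, -⟩ <;> omega
        have h1 := cellFrontier_subset_skeletonLT n e hx
        rw [← Topology.CWComplex.iUnion_openCell_eq_skeletonLT] at h1
        simp only [Set.mem_iUnion] at h1 ⊢
        obtain ⟨m, hm, j, hj⟩ := h1
        have hm' : m < n := by exact_mod_cast hm
        exact ⟨m, ⟨j, Or.inl (by omega)⟩, hj⟩
      · exact Set.mem_iUnion.2 ⟨n, Set.mem_iUnion.2 ⟨⟨e, he⟩, hx⟩⟩)
    rfl

theorem skeletonUnion_I (k : ℕ) (S : Set (cell C (k + 1))) :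
    (skeletonUnion C k S).I = skeletonCells k S := rfl

/-- Reduces the sum over trees to a sum over sets of `(k+1)`-cells. -/
theorem eq_skeletonUnion {k : ℕ} {T : Subcomplex C} (h₁ : T ≤ skeleton C ((k + 1 : ℕ) : ℕ∞))
    (h₂ : skeleton C (k : ℕ∞) ≤ T) : T = skeletonUnion C k (T.I (k + 1)) := by
  have hI : ∀ n, T.I n = skeletonCells k (T.I (k + 1)) n := by
    intro n
    rcases lt_trichotomy n (k + 1) with h | rfl | h
    · rw [skeletonCells_of_le (Nat.le_of_lt_succ h)]
      ext e
      simp only [Set.mem_univ, iff_true]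
      exact (subcomplex_le_iff _ _).1 h₂ n ((mem_skeleton_I k n e).2 (Nat.le_of_lt_succ h))
    · rw [skeletonCells_succ]
    · rw [skeletonCells_of_lt h]
      ext e
      simp only [Set.mem_empty_iff_false, iff_false]
      intro he
      have := (mem_skeleton_I (k + 1) n e).1 ((subcomplex_le_iff _ _).1 h₁ n he)
      omega
  exact le_antisymm ((subcomplex_le_iff _ _).2 fun n => (hI n).subset)
    ((subcomplex_le_iff _ _).2 fun n => (hI n).superset)

theorem skeleton_I_eq (k : ℕ) :
    (skeleton C ((k + 1 : ℕ) : ℕ∞)).I = skeletonCells k (Set.univ : Set (cell C (k + 1))) := by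
  funext n
  ext e
  rw [mem_skeleton_I]
  rcases lt_trichotomy n (k + 1) with h | rfl | h
  · simp [skeletonCells_of_le (Nat.le_of_lt_succ h), h.le]
  · simp [skeletonCells_succ]
  · simp [skeletonCells_of_lt h, h]

theorem skeletonUnion_le (k : ℕ) (S : Set (cell C (k + 1))) :
    skeletonUnion C k S ≤ skeleton C ((k + 1 : ℕ) : ℕ∞) := by
  refine (subcomplex_le_iff _ _).2 fun n e he => (mem_skeleton_I _ n e).2 ?_
  rcases he with h | ⟨h, -⟩ <;> omega

theorem le_skeletonUnion (k : ℕ) (S : Set (cell C (k + 1))) :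
    skeleton C (k : ℕ∞) ≤ skeletonUnion C k S :=
  (subcomplex_le_iff _ _).2 fun n e he => Or.inl ((mem_skeleton_I k n e).1 he)

/-! ### Homology of the union of a skeleton with a set of cells -/

theorem cycles_skeletonCells (o : CellOrientation C) (A : Type) [CommRing A] (k : ℕ)
    (S : Set (cell C (k + 1))) :
    cycles o A (skeletonCells k S) k = cycles o A (allCells C) k := by
  have h : chains A (skeletonCells k S) k = chains A (allCells C) k := by
    ext c
    exact forall_congr' fun e => by rw [skeletonCells_of_le le_rfl]
  cases k with
  | zero => exact h
  | succ k => exact congrArg (· ⊓ LinearMap.ker (boundary o A k)) h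

/-- There are no `(k+2)`-cells, so `H_{k+1}` is the group of cycles: its vanishing says that the
boundaries of the cells in `S` are independent over `ℤ`. -/
theorem subsingleton_homology_iff (o : CellOrientation C) (k : ℕ) (S : Set (cell C (k + 1))) :
    Subsingleton (Homology o ℤ (skeletonCells k S) (k + 1)) ↔
      ∀ c : cell C (k + 1) → ℤ, (∀ e, e ∉ S → c e = 0) → boundary o ℤ k c = 0 → c = 0 := by
  have hb : boundaries o ℤ (skeletonCells k S) (k + 1) = ⊥ := by
    classical
    rw [boundaries_eq_span, skeletonCells_of_lt (Nat.lt_succ_self _), Set.image_empty,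
      Submodule.span_empty]
  have hz : ∀ c : cell C (k + 1) → ℤ, c ∈ cycles o ℤ (skeletonCells k S) (k + 1) ↔
      (∀ e, e ∉ S → c e = 0) ∧ boundary o ℤ k c = 0 := by
    intro c
    refine and_congr ?_ Iff.rfl
    exact forall_congr' fun e => by rw [skeletonCells_succ]
  rw [Submodule.Quotient.subsingleton_iff, hb, Submodule.submoduleOf_eq_top]
  constructor
  · intro h c h1 h2
    exact h ((hz c).2 ⟨h1, h2⟩)
  · intro h c hc
    obtain ⟨h1, h2⟩ := (hz c).1 hc
    exact h c h1 h2

/-- The space of `k`-cycles does not depend on `S`, so comparing Betti numbers amounts to comparing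
dimensions of boundaries. -/
theorem betti_skeletonCells (o : CellOrientation C) (k : ℕ) (S : Set (cell C (k + 1))) :
    betti o (skeletonCells k S) k + finrank ℝ (boundaries o ℝ (skeletonCells k S) k) =
      finrank ℝ (cycles o ℝ (allCells C) k) := by
  have hle : boundaries o ℝ (skeletonCells k S) k ≤ cycles o ℝ (allCells C) k :=
    (boundaries_mono o ℝ _ k).trans (boundaries_le_cycles o ℝ k)
  have h := Submodule.finrank_quotient_add_finrank
    ((boundaries o ℝ (skeletonCells k S) k).submoduleOf (cycles o ℝ (allCells C) k))
  rw [(Submodule.submoduleOfEquivOfLe hle).finrank_eq] at h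
  unfold betti
  change finrank ℝ (cycles o ℝ (skeletonCells k S) k ⧸ Submodule.submoduleOf _ _) + _ = _
  rw [cycles_skeletonCells]
  exact h

theorem boundaries_skeletonCells_univ (o : CellOrientation C) (A : Type) [CommRing A] (k : ℕ) :
    boundaries o A (skeletonCells k Set.univ) k = boundaries o A (allCells C) k := by
  classical
  rw [boundaries_eq_span, boundaries_eq_span, skeletonCells_succ]

/-- In matroid terms: the boundaries of the cells in `S` are independent and span `B_k(X; ℝ)`, so
trees are the bases of the column matroid of `∂`. -/
theorem isSpanningTree_skeletonUnion_iff (o : CellOrientation C) (k : ℕ)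
    (S : Set (cell C (k + 1))) :
    IsSpanningTree o k (skeletonUnion C k S) ↔
      (∀ c : cell C (k + 1) → ℤ, (∀ e, e ∉ S → c e = 0) → boundary o ℤ k c = 0 → c = 0) ∧
        finrank ℝ (boundaries o ℝ (skeletonCells k S) k) =
          finrank ℝ (boundaries o ℝ (allCells C) k) := by
  have hbetti : betti o (skeletonUnion C k S).I k =
      betti o (skeleton C ((k + 1 : ℕ) : ℕ∞)).I k ↔
        finrank ℝ (boundaries o ℝ (skeletonCells k S) k) =
          finrank ℝ (boundaries o ℝ (allCells C) k) := by
    have h1 := betti_skeletonCells o k S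
    have h2 := betti_skeletonCells o k Set.univ
    rw [boundaries_skeletonCells_univ] at h2
    rw [skeletonUnion_I, skeleton_I_eq]
    omega
  constructor
  · intro h
    exact ⟨(subsingleton_homology_iff o k S).1 h.homology_top, hbetti.1 h.betti_eq⟩
  · rintro ⟨h1, h2⟩
    exact ⟨skeletonUnion_le k S, (subsingleton_homology_iff o k S).2 h1, hbetti.2 h2,
      le_skeletonUnion k S⟩

/-! ### Spanning trees and minors -/

/-- Acyclicity embeds `ℤ^S` into the coordinates of `B_k`, which bounds the cardinality above; the
rank condition bounds it below. -/
theorem card_eq_of_isSpanningTree {o : CellOrientation C} {k : ℕ} {S : Finset (cell C (k + 1))}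
    (h : IsSpanningTree o k (skeletonUnion C k S)) :
    S.card = finrank ℝ (boundaries o ℝ (allCells C) k) := by
  classical
  obtain ⟨h1, h2⟩ := (isSpanningTree_skeletonUnion_iff o k S).1 h
  apply le_antisymm
  · obtain ⟨b⟩ := exists_integral_basis o k
    let g : (S → ℤ) →ₗ[ℤ] (cell C (k + 1) → ℤ) :=
      Function.ExtendByZero.linearMap ℤ ((↑) : S → cell C (k + 1))
    have hg : Function.Injective (boundaryCoords b ∘ₗ g) := by
      rw [← LinearMap.ker_eq_bot, Submodule.eq_bot_iff]
      intro v hv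
      have h3 : g v = 0 := by
        refine h1 _ (fun e he => ?_) ((boundaryCoords_eq_zero_iff b _).1 hv)
        exact Function.extend_apply' _ _ _ fun ⟨a, ha⟩ => he (ha ▸ a.2)
      ext i
      have h4 := congrFun h3 (i : cell C (k + 1))
      rwa [show g v i = v i from Subtype.val_injective.extend_apply _ _ _] at h4
    have := LinearMap.finrank_le_finrank_of_injective hg
    simpa using this
  · rw [← h2, boundaries_eq_span, skeletonCells_succ, ← Finset.coe_image]
    exact (finrank_span_finset_le_card _).trans Finset.card_image_le

section Minors

variable {o : CellOrientation C} {k : ℕ} {ι : Type*} [Fintype ι] [DecidableEq ι]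

/-- Extension by zero identifies the kernel of the square submatrix with the integral cycles
supported on the selected cells. As their number is the rank of `B_k`, their independence also makes
them span over `ℝ`. -/
theorem isSpanningTree_iff_minor_ne_zero (b : Basis ι ℤ (boundaries o ℤ (allCells C) k))
    {f : ι → cell C (k + 1)} (hf : Function.Injective f) :
    IsSpanningTree o k (skeletonUnion C k (Set.range f)) ↔
      ((boundaryMatrix b).submatrix id f).det ≠ 0 := by
  classical
  have hext : ∀ v : ι → ℤ, boundaryMatrix b *ᵥ Function.extend f v 0 =
      (boundaryMatrix b).submatrix id f *ᵥ v := by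
    intro v
    ext i
    simp only [mulVec, dotProduct, submatrix_apply, id_eq]
    rw [← Finset.sum_subset (Finset.subset_univ (Finset.univ.image f)),
      Finset.sum_image fun _ _ _ _ h => hf h]
    · exact Finset.sum_congr rfl fun j _ => by rw [hf.extend_apply]
    · intro e _ he
      rw [Function.extend_apply', Pi.zero_apply, mul_zero]
      rintro ⟨a, rfl⟩
      exact he (Finset.mem_image_of_mem _ (Finset.mem_univ a))
  have hbd : ∀ c, boundaryMatrix b *ᵥ c = 0 ↔ boundary o ℤ k c = 0 := fun c => by
    rw [boundaryMatrix_mulVec, boundaryCoords_eq_zero_iff]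
  rw [isSpanningTree_skeletonUnion_iff]
  constructor
  · rintro ⟨h1, -⟩ hd
    obtain ⟨v, hv, hv0⟩ := Matrix.exists_mulVec_eq_zero_iff.2 hd
    refine hv ?_
    have h2 := h1 (Function.extend f v 0)
      (fun e he => by rw [Function.extend_apply' _ _ _ he, Pi.zero_apply])
      ((hbd _).1 ((hext v).trans hv0))
    ext i
    rw [← hf.extend_apply v 0 i, h2, Pi.zero_apply, Pi.zero_apply]
  · intro hd
    constructor
    · intro c hc hc0
      have h1 : c = Function.extend f (c ∘ f) 0 := by
        ext e
        by_cases he : e ∈ Set.range f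
        · obtain ⟨i, rfl⟩ := he
          rw [hf.extend_apply, Function.comp_apply]
        · rw [hc e he, Function.extend_apply' _ _ _ he, Pi.zero_apply]
      have h2 : c ∘ f = 0 := by
        by_contra hne
        refine hd (Matrix.exists_mulVec_eq_zero_iff.1 ⟨c ∘ f, hne, ?_⟩)
        rw [← hext, ← h1]
        exact (hbd c).2 hc0
      rw [h1, h2]
      ext e
      by_cases he : e ∈ Set.range f
      · obtain ⟨i, rfl⟩ := he
        rw [hf.extend_apply, Pi.zero_apply, Pi.zero_apply]
      · rw [Function.extend_apply' _ _ _ he]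
    · have h1 := realChain_linearIndependent (linearIndependent_of_minor_ne_zero b hd)
      simp only [realChain_boundary_single] at h1
      rw [boundaries_eq_span, skeletonCells_succ, ← Set.range_comp,
        Module.finrank_eq_card_basis (realBasis b)]
      exact finrank_span_eq_card h1

/-- The tree and `X` have the same `k`-cycles, so their torsion orders differ by the index of the
boundary lattices. -/
theorem torsionOrder_skeletonUnion (b : Basis ι ℤ (boundaries o ℤ (allCells C) k))
    {f : ι → cell C (k + 1)} (hd : ((boundaryMatrix b).submatrix id f).det ≠ 0) :
    torsionOrder o (skeletonUnion C k (Set.range f)).I k =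
      ((boundaryMatrix b).submatrix id f).det.natAbs * torsionOrder o (allCells C) k := by
  rw [skeletonUnion_I]
  have hrel := relIndex_boundaries b hd (skeletonCells_succ k (Set.range f))
  have h := card_torsion_quotient_submoduleOf
    (boundaries_mono o ℤ (skeletonCells k (Set.range f)) k) (boundaries_le_cycles o ℤ k) (by rw [hrel]; exact Int.natAbs_ne_zero.2 hd)
  rw [hrel] at h
  unfold torsionOrder
  change Nat.card (AddCommGroup.torsion
    (cycles o ℤ (skeletonCells k (Set.range f)) k ⧸ Submodule.submoduleOf _ _)) = _
  rw [cycles_skeletonCells]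
  exact h

end Minors

theorem torsionOrder_ne_zero (o : CellOrientation C) (k : ℕ) :
    torsionOrder o (allCells C) k ≠ 0 :=
  card_torsion_ne_zero _

/-- The weighted count of spanning trees as a determinant. -/
theorem sum_torsionOrder_sq {o : CellOrientation C} {k : ℕ}
    (b : Basis (Fin (finrank ℝ (boundaries o ℝ (allCells C) k))) ℤ
      (boundaries o ℤ (allCells C) k)) :
    ∑ T ∈ spanningTrees o k, (torsionOrder o T.I k : ℝ) ^ 2 =
      (torsionOrder o (allCells C) k : ℝ) ^ 2 *
        (boundaryMatrix (realBasis b) * (boundaryMatrix (realBasis b))ᵀ).det := by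
  classical
  have hθ : (torsionOrder o (allCells C) k : ℝ) ≠ 0 :=
    Nat.cast_ne_zero.2 (torsionOrder_ne_zero o k)
  have hmem : ∀ T, T ∈ spanningTrees o k ↔ IsSpanningTree o k T := fun T => by
    simp [spanningTrees]
  have hcoe : ∀ f : Fin (finrank ℝ (boundaries o ℝ (allCells C) k)) → cell C (k + 1),
      ((Finset.univ.image f : Finset (cell C (k + 1))) : Set (cell C (k + 1))) = Set.range f := by
    intro f
    rw [Finset.coe_image, Finset.coe_univ, Set.image_univ]
  -- The weight is the squared minor on the columns `S`, written without ordering `S`: the squared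
  -- index for a tree and `0` otherwise.
  rw [det_mul_transpose_eq_sum (boundaryMatrix (realBasis b))
    (fun S => if IsSpanningTree o k (skeletonUnion C k S) then
      ((torsionOrder o (skeletonUnion C k S).I k : ℝ) / torsionOrder o (allCells C) k) ^ 2 else 0),
    Finset.mul_sum]
  · simp only [mul_ite, mul_zero]
    rw [← Finset.sum_filter]
    refine Finset.sum_bij' (fun T _ => (T.I (k + 1)).toFinset) (fun S _ => skeletonUnion C k S)
      ?_ ?_ ?_ ?_ ?_
    · intro T hT
      rw [hmem] at hT
      have hT' := hT
      rw [eq_skeletonUnion hT.le_skeleton hT.skeleton_le, ← Set.coe_toFinset (T.I (k + 1))] at hT'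
      rw [Finset.mem_filter, Finset.mem_powersetCard, Fintype.card_fin]
      exact ⟨⟨Finset.subset_univ _, card_eq_of_isSpanningTree hT'⟩, hT'⟩
    · intro S hS
      exact (hmem _).2 (Finset.mem_filter.1 hS).2
    · intro T hT
      rw [hmem] at hT
      rw [Set.coe_toFinset]
      exact (eq_skeletonUnion hT.le_skeleton hT.skeleton_le).symm
    · intro S _
      ext e
      rw [Set.mem_toFinset, skeletonUnion_I, skeletonCells_succ, Finset.mem_coe]
    · intro T hT
      rw [hmem] at hT
      rw [Set.coe_toFinset, ← eq_skeletonUnion hT.le_skeleton hT.skeleton_le, div_pow,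
        mul_div_cancel₀ _ (pow_ne_zero 2 hθ)]
  · intro f hf
    have hdet : ((boundaryMatrix (realBasis b)).submatrix id f).det =
        (((boundaryMatrix b).submatrix id f).det : ℝ) := by
      rw [boundaryMatrix_realBasis, Int.cast_det]
      rfl
    rw [hdet, hcoe]
    by_cases hd : ((boundaryMatrix b).submatrix id f).det = 0
    · rw [if_neg (fun h => (isSpanningTree_iff_minor_ne_zero b hf).1 h hd), hd]
      simp
    · rw [if_pos ((isSpanningTree_iff_minor_ne_zero b hf).2 hd), torsionOrder_skeletonUnion b hd,
        Nat.cast_mul, mul_div_cancel_right₀ _ hθ, Nat.cast_natAbs, Int.cast_abs, sq_abs]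

/-! ### Comparison of the factors -/

theorem eta_ne_zero {o : CellOrientation C} (h : HomologyBasis o) (hh : IsCombinatorial o h)
    (n : ℕ) : eta o n ≠ 0 := by
  rw [eta_eq_det h hh]
  exact det_chainMatrix_gram_ne_zero _ (harmonicBasis_linearIndependent h n)

-- `θ_k²` cancels against the tree sum, and `μ_k` with the integral determinant is traded for the
-- same product in the basis `D.b k`. The last two factors are the same quantity in consecutive
-- degrees, which makes the alternating product telescope.
open Classical in
theorem delta_mul_sum_eq {o : CellOrientation C} (h : HomologyBasis o) (hh : IsCombinatorial o h)
    (D : TorsionChoices o) (k : ℕ) :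
    delta o k * ∑ T ∈ spanningTrees o k, (torsionOrder o T.I k : ℝ) ^ 2 =
      (changeOfBasis h D k).det ^ 2 * (prevMatrix D k * (prevMatrix D k)ᵀ).det *
        (prevMatrix D (k + 1) * (prevMatrix D (k + 1))ᵀ).det := by
  obtain ⟨b⟩ := exists_integral_basis o k
  have hθ : (torsionOrder o (allCells C) k : ℝ) ≠ 0 :=
    Nat.cast_ne_zero.2 (torsionOrder_ne_zero o k)
  have h1 := det_gram_mul_det_boundaryMatrix_eq (D.b k) (realBasis b)
  rw [← mu_eq_det b] at h1
  rw [det_changeOfBasis_sq h hh D k, sum_torsionOrder_sq b, delta]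
  change _ = _ * (boundaryMatrix (D.b k) * (boundaryMatrix (D.b k))ᵀ).det
  rw [mul_right_comm, h1]
  field_simp

/-- It is a factor of a product of Gram determinants of independent families. -/
theorem det_prevMatrix_ne_zero {o : CellOrientation C} (h : HomologyBasis o)
    (hh : IsCombinatorial o h) (D : TorsionChoices o) (n : ℕ) :
    (prevMatrix D n * (prevMatrix D n)ᵀ).det ≠ 0 := by
  classical
  refine right_ne_zero_of_mul (a := (changeOfBasis h D n).det ^ 2) ?_
  rw [det_changeOfBasis_sq h hh D n]
  exact mul_ne_zero (det_chainMatrix_gram_ne_zero _ (linearIndependent_coe_basis (D.b n)))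
    (eta_ne_zero h hh n)

theorem det_prevMatrix_zero {o : CellOrientation C} (D : TorsionChoices o) :
    (prevMatrix D 0 * (prevMatrix D 0)ᵀ).det = 1 := by
  have : IsEmpty (Fin (prevRank o 0)) := inferInstanceAs (IsEmpty (Fin 0))
  exact det_isEmpty

theorem det_prevMatrix_of_isEmpty {o : CellOrientation C} (D : TorsionChoices o) (n : ℕ)
    [hn : IsEmpty (cell C n)] : (prevMatrix D n * (prevMatrix D n)ᵀ).det = 1 := by
  cases n with
  | zero => exact det_prevMatrix_zero D
  | succ n =>
    have hb : boundaries o ℝ (allCells C) n = ⊥ := by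
      rw [eq_bot_iff]
      rintro _ ⟨c, -, rfl⟩
      rw [Subsingleton.elim c 0, map_zero]
      exact Submodule.zero_mem _
    have h0 : prevRank o (n + 1) = 0 := by
      change finrank ℝ (boundaries o ℝ (allCells C) n) = 0
      rw [hb, finrank_bot]
    have : IsEmpty (Fin (prevRank o (n + 1))) := by
      rw [h0]
      infer_instance
    exact det_isEmpty

/-- An alternating product with cancelling consecutive factors. -/
theorem prod_alternating_telescope (u p : ℕ → ℝ) (hp : ∀ n, p n ≠ 0) (h0 : p 0 = 1) (N : ℕ) :
    ∏ k ∈ Finset.range N, (u k ^ 2 * p k * p (k + 1)) ^ ((-1 : ℤ) ^ k) =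
      (∏ k ∈ Finset.range N, u k ^ ((-1 : ℤ) ^ k)) ^ 2 * p N ^ (-(-1 : ℤ) ^ N) := by
  induction N with
  | zero => simp [h0]
  | succ N ih =>
    have hN : -(-1 : ℤ) ^ (N + 1) = (-1) ^ N := by ring
    have hpN := zpow_ne_zero ((-1 : ℤ) ^ N) (hp N)
    -- The leftover power of `p N` cancels the one in the new factor, leaving `p (N + 1)` with
    -- exponent `(-1) ^ N`.
    rw [Finset.prod_range_succ, Finset.prod_range_succ, ih, hN, mul_zpow, mul_zpow, _root_.zpow_neg,
      ← zpow_natCast (u N), ← _root_.zpow_mul, mul_comm ((2 : ℕ) : ℤ), _root_.zpow_mul, zpow_natCast]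
    field_simp

end Cellular

end TorsionTree

/-! ### The torsion formula. -/

theorem theoremC {X : Type*} [TopologicalSpace X] [T2Space X] (C : Set X)
    [Topology.CWComplex C] [Topology.CWComplex.Finite C] (hC : IsConnected C)
    (o : TorsionTree.CellOrientation C) (h : TorsionTree.HomologyBasis o)
    (hh : TorsionTree.IsCombinatorial o h) (D : TorsionTree.TorsionChoices o) :
    TorsionTree.torsion h D ^ 2 =
      ∏ᶠ k : ℕ, (TorsionTree.delta o k *
        ∑ T ∈ TorsionTree.spanningTrees o k, (TorsionTree.torsionOrder o T.I k : ℝ) ^ 2) ^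
          ((-1 : ℤ) ^ k) := by
  classical
  obtain ⟨N, hN⟩ := Filter.eventually_atTop.1
    (Topology.RelCWComplex.FiniteDimensional.eventually_isEmpty_cell (C := C) (D := ∅))
  have hp : ∀ n, N ≤ n →
      (TorsionTree.prevMatrix D n * (TorsionTree.prevMatrix D n).transpose).det = 1 := fun n hn =>
    have := hN n hn
    TorsionTree.det_prevMatrix_of_isEmpty D n
  have hu : ∀ n, N ≤ n → (TorsionTree.changeOfBasis h D n).det = 1 := fun n hn => by
    have := hN n hn
    convert Matrix.det_isEmpty
    exact this
  simp only [TorsionTree.delta_mul_sum_eq h hh D]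
  -- From degree `N` on there are no cells and every factor is `1`, so both infinite products are
  -- products over `range N`; the boundary term `p N` of the telescope is `1` as well.
  rw [TorsionTree.torsion, finprod_eq_prod_of_mulSupport_subset (s := Finset.range N),
    finprod_eq_prod_of_mulSupport_subset (s := Finset.range N),
    TorsionTree.prod_alternating_telescope _ _ (TorsionTree.det_prevMatrix_ne_zero h hh D)
      (TorsionTree.det_prevMatrix_zero D), hp N le_rfl, one_zpow, mul_one]
  · intro n hn
    rw [Finset.coe_range, Set.mem_Iio]
    by_contra hle
    rw [not_lt] at hle
    refine hn ?_
    simp only [hp n hle, hp (n + 1) (hle.trans n.le_succ), hu n hle, one_pow, mul_one, one_zpow]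
  · intro n hn
    rw [Finset.coe_range, Set.mem_Iio]
    by_contra hle
    rw [not_lt] at hle
    refine hn ?_
    simp only [hu n hle, one_zpow]
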